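/- **Setting.** Let $X$ and $Y$ be sets with countably generated $\sigma$-algebras and $\sigma$-finite measures $\mu$, $\nu$, and let $f:X\times Y\to[0,\infty)$ be a probability density with respect to $\mu\times\nu$, with marginal densities $f_X(x)=\int f(x,y)\,\nu(dy)$, $f_Y(y)=\int f(x,y)\,\mu(dx)$ and conditional densities $f_{X|Y}(x|y)=f(x,y)/f_Y(y)$, $f_{Y|X}(y|x)=f(x,y)/f_X(x)$. Let $L^2_0(f_X)$ and $L^2_0(f_Y)$ be the real Hilbert spaces of square integrable functions with mean zero with respect to $f_X\,d\mu$ and $f_Y\,d\nu$. Let $R(y,dy')$ be a Markov transition function on $Y$ that is reversible with respect to $f_Y(y)\,\nu(dy)$. The data augmentation chain and the sandwich chain on $X$ have the transition densities $$k(x'|x)=\int_Y f_{X|Y}(x'|y)f_{Y|X}(y|x)\,\nu(dy),\qquad k^*(x'|x)=\int_Y\int_Y f_{X|Y}(x'|y')\,R(y,dy')\,f_{Y|X}(y|x)\,\nu(dy).$$ Let $K$, $K^*$ (on $L^2_0(f_X)$) and $R$ (on $L^2_0(f_Y)$) be the corresponding Markov operators, e.g. $(Kg)(x)=\int g(x')k(x'|x)\,\mu(dx')$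 and $(Rh)(y)=\int h(y')R(y,dy')$, and let $\|\cdot\|$ denote the operator norm. For a positive compact operator let the ordered eigenvalues be its positive eigenvalues in decreasing order, repeated according to multiplicity, continued by zeros if there are only finitely many; its trace is their sum, and it is trace-class if this sum is finite. Denote the ordered eigenvalues of $K$ and $K^*$ by $(\lambda_i)_{i\ge1}$ and $(\lambda^*_i)_{i\ge1}$. A *singular value decomposition* of $f$ consists of numbers $1\ge\beta_1\ge\beta_2\ge\dots\ge0$ and functions $g_i\in L^2_0(f_X)$, $h_i\in L^2_0(f_Y)$ $(i\ge1)$ such that $\{g_i:\beta_i>0\}$ and $\{h_i:\beta_i>0\}$ are orthonormal and $$\frac{f(x,y)}{f_X(x)f_Y(y)}=1+\sum_{i=1}^\infty\beta_i\,g_i(x)h_i(y)$$ with convergence in $L^2$ of the product of the laws $f_X\,d\mu$ and $f_Y\,d\nu$. **Theorem.** Assume that $$\int_X\int_Y f_{X|Y}(x|y)f_{Y|X}(y|x)\,\nu(dy)\,\mu(dx)<\infty$$ and that the operator $R$ is idempotent with $\|R\|=1$. Then: 1. $K$ and $K^*$ are positive trace-class operators. 2. $\lambda^*_i\le\lambda_i$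 for all $i\ge1$. Moreover, $f$ has a singular value decomposition, and for every singular value decomposition $(\beta_i,g_i,h_i)_{i\ge1}$ of $f$: 3. $\lambda^*_i=\lambda_i$ for all $i\ge1$ if and only if $Rh_i=h_i$ for every $i$ with $\beta_i>0$; likewise, $\operatorname{tr}K^*=\operatorname{tr}K$ if and only if $Rh_i=h_i$ for every $i$ with $\beta_i>0$. 4. If $\beta_1>0$, then $l=\max\{i\ge1:\beta_i=\beta_1\}$ exists, and $\|K^*\|<\|K\|$ if and only if the only $a=(a_1,\dots,a_l)\in\mathbb R^l$ with $R\sum_{i=1}^l a_ih_i=\sum_{i=1}^l a_ih_i$ is $a=0$. -/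

import Mathlib

open MeasureTheory ProbabilityTheory Filter Topology
open scoped ENNReal NNReal

namespace DataAugmentation

/-! ### The Hilbert space of square integrable functions with mean zero -/

/-- `L²₀(π)`: the real square integrable functions (modulo `π`-null sets) with mean zero, as a
subspace of `L²(π)`, whose inner product and norm it inherits. -/
noncomputable def L20 {α : Type*} [MeasurableSpace α] (π : Measure α) [IsFiniteMeasure π] :
    Submodule ℝ (Lp ℝ 2 π) where
  carrier := {g | ∫ x, g x ∂π = 0}
  zero_mem' := by
    show ∫ x, (0 : Lp ℝ 2 π) x ∂π = 0
    rw [integral_congr_ae (Lp.coeFn_zero ℝ 2 π)]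
    simp
  add_mem' := by
    intro a b ha hb
    have h1 : Integrable a π := (Lp.memLp a).integrable (by norm_num)
    have h2 : Integrable b π := (Lp.memLp b).integrable (by norm_num)
    show ∫ x, (a + b) x ∂π = 0
    rw [integral_congr_ae (Lp.coeFn_add a b)]
    simp only [Pi.add_apply]
    rw [integral_add h1 h2]
    have ha' : ∫ x, a x ∂π = 0 := ha
    have hb' : ∫ x, b x ∂π = 0 := hb
    rw [ha', hb', add_zero]
  smul_mem' := by
    intro c a ha
    show ∫ x, (c • a) x ∂π = 0
    rw [integral_congr_ae (Lp.coeFn_smul c a)]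
    simp only [Pi.smul_apply]
    rw [integral_smul]
    have ha' : ∫ x, a x ∂π = 0 := ha
    rw [ha', smul_zero]

/-! ### The operator defined by a transition function -/

/-- `κ` is a transition function (of total mass at most one, so that it may be `0` on a null set
where a conditional density is not defined) which carries the law `π` to the law `π'`.
For `π = π'` this says that `π` is invariant. -/
structure Transports {α β : Type*} [MeasurableSpace α] [MeasurableSpace β] (κ : Kernel α β)
    (π : Measure α) (π' : Measure β) : Prop where
  mass_le_one : ∀ x, κ x Set.univ ≤ 1
  bind_eq : π.bind κ = π'

theorem Transports.comp {α β γ : Type*} [MeasurableSpace α] [MeasurableSpace β]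
    [MeasurableSpace γ] {κ : Kernel α β} {η : Kernel β γ} {π : Measure α} {π' : Measure β}
    {π'' : Measure γ} (hη : Transports η π' π'') (hκ : Transports κ π π') :
    Transports (η ∘ₖ κ) π π'' where
  mass_le_one x := by
    rw [Kernel.comp_apply' _ _ _ MeasurableSet.univ]
    calc ∫⁻ y, η y Set.univ ∂κ x ≤ ∫⁻ _, 1 ∂κ x := lintegral_mono fun y => hη.mass_le_one y
      _ ≤ 1 := by simpa using hκ.mass_le_one x
  bind_eq := by
    rw [← hη.bind_eq, ← hκ.bind_eq, Measure.comp_assoc]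

section KernelOp

variable {α β : Type*} [MeasurableSpace α] [MeasurableSpace β] {κ : Kernel α β}
  {π : Measure α} {π' : Measure β}

theorem Transports.isFiniteKernel (h : Transports κ π π') : IsFiniteKernel κ :=
  ⟨1, by simp, h.mass_le_one⟩

theorem Transports.eLpNorm_le (h : Transports κ π π') {g : β → ℝ} (hg : StronglyMeasurable g) :
    eLpNorm (fun x => ∫ y, g y ∂κ x) 2 π ≤ eLpNorm g 2 π' := by
  have key : ∀ x, ‖∫ y, g y ∂κ x‖ₑ ^ (2 : ℝ) ≤ ∫⁻ y, ‖g y‖ₑ ^ (2 : ℝ) ∂κ x := by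
    intro x
    have h1 : ‖∫ y, g y ∂κ x‖ₑ ≤ eLpNorm g 1 (κ x) := by
      rw [eLpNorm_one_eq_lintegral_enorm]
      exact enorm_integral_le_lintegral_enorm _
    have h2 : eLpNorm g 1 (κ x) ≤ eLpNorm g 2 (κ x) := by
      refine (eLpNorm_le_eLpNorm_mul_rpow_measure_univ (p := 1) (q := 2) (by norm_num)
        hg.aestronglyMeasurable).trans ?_
      have h3 : κ x Set.univ ^ (1 / (1 : ℝ≥0∞).toReal - 1 / (2 : ℝ≥0∞).toReal) ≤ 1 :=
        ENNReal.rpow_le_one (h.mass_le_one x) (by norm_num)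
      calc _ ≤ eLpNorm g 2 (κ x) * 1 := by gcongr
        _ = _ := mul_one _
    calc ‖∫ y, g y ∂κ x‖ₑ ^ (2 : ℝ) ≤ eLpNorm g 2 (κ x) ^ (2 : ℝ) := by
          gcongr
          exact h1.trans h2
      _ = _ := by
        rw [eLpNorm_eq_lintegral_rpow_enorm_toReal (by norm_num) (by norm_num),
          ← ENNReal.rpow_mul]
        norm_num
  rw [eLpNorm_eq_lintegral_rpow_enorm_toReal (by norm_num) (by norm_num),
    eLpNorm_eq_lintegral_rpow_enorm_toReal (by norm_num) (by norm_num)]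
  gcongr
  simp only [ENNReal.toReal_ofNat]
  calc ∫⁻ x, ‖∫ y, g y ∂κ x‖ₑ ^ (2 : ℝ) ∂π ≤ ∫⁻ x, ∫⁻ y, ‖g y‖ₑ ^ (2 : ℝ) ∂κ x ∂π :=
        lintegral_mono key
    _ = ∫⁻ y, ‖g y‖ₑ ^ (2 : ℝ) ∂(π.bind κ) := by
        rw [Measure.lintegral_bind κ.measurable.aemeasurable]
        exact (hg.enorm.pow_const _).aemeasurable
    _ = _ := by rw [h.bind_eq]

theorem Transports.memLp (h : Transports κ π π') (g : Lp ℝ 2 π') :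
    MemLp (fun x => ∫ y, g y ∂κ x) 2 π := by
  have := h.isFiniteKernel
  exact ⟨((Lp.stronglyMeasurable g).integral_kernel).aestronglyMeasurable,
    (h.eLpNorm_le (Lp.stronglyMeasurable g)).trans_lt (Lp.memLp g).2⟩

theorem Transports.ae_ae (h : Transports κ π π') {p : β → Prop} (hp : ∀ᵐ y ∂π', p y) :
    ∀ᵐ x ∂π, ∀ᵐ y ∂κ x, p y := by
  rw [← h.bind_eq] at hp
  exact Measure.ae_ae_of_ae_comp hp

theorem Transports.integral_eq (h : Transports κ π π') [IsFiniteMeasure π] {g : β → ℝ}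
    (hg : Integrable g π') : ∫ x, ∫ y, g y ∂κ x ∂π = ∫ y, g y ∂π' := by
  have := h.isFiniteKernel
  have h0 : (κ ∘ₖ Kernel.const Unit π) () = π' := by
    rw [Kernel.comp_apply, Kernel.const_apply, h.bind_eq]
  have h1 : Integrable g ((κ ∘ₖ Kernel.const Unit π) ()) := by rw [h0]; exact hg
  rw [← h0, Kernel.integral_comp h1, Kernel.const_apply]

/-- The operator `L²₀(π') → L²₀(π)` defined by a transition function `κ` which carries `π` to
`π'`: it maps `g` to `x ↦ ∫ g(y) κ(x, dy)`. -/
noncomputable def kernelOp (κ : Kernel α β) (π : Measure α) (π' : Measure β)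
    [IsFiniteMeasure π] [IsFiniteMeasure π'] (h : Transports κ π π') : L20 π' →L[ℝ] L20 π :=
  LinearMap.mkContinuous
    { toFun := fun g => ⟨(h.memLp g.1).toLp (fun x => ∫ y, g.1 y ∂κ x), by
        show ∫ x, (h.memLp g.1).toLp (fun x => ∫ y, g.1 y ∂κ x) x ∂π = 0
        rw [integral_congr_ae (h.memLp g.1).coeFn_toLp,
          h.integral_eq ((Lp.memLp g.1).integrable (by norm_num))]
        exact g.2⟩
      map_add' := by
        intro a b
        apply Subtype.ext
        apply Lp.ext
        have hint : ∀ c : Lp ℝ 2 π', ∀ᵐ x ∂π, Integrable c (κ x) := by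
          intro c
          have := h.isFiniteKernel
          have hc : Integrable c (π.bind κ) := by
            rw [h.bind_eq]; exact (Lp.memLp c).integrable (by norm_num)
          exact Measure.ae_integrable_of_integrable_comp hc
        refine (h.memLp _).coeFn_toLp.trans ?_
        refine EventuallyEq.trans ?_ (Lp.coeFn_add _ _).symm
        filter_upwards [(h.memLp a.1).coeFn_toLp, (h.memLp b.1).coeFn_toLp, hint a.1, hint b.1,
          h.ae_ae (Lp.coeFn_add a.1 b.1)] with x h1 h2 h3 h4 h5
        rw [Pi.add_apply, h1, h2, ← integral_add h3 h4]
        exact integral_congr_ae h5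
      map_smul' := by
        intro c a
        apply Subtype.ext
        apply Lp.ext
        refine (h.memLp _).coeFn_toLp.trans ?_
        refine EventuallyEq.trans ?_ (Lp.coeFn_smul _ _).symm
        filter_upwards [(h.memLp a.1).coeFn_toLp, h.ae_ae (Lp.coeFn_smul c a.1)] with x h1 h2
        rw [Pi.smul_apply, RingHom.id_apply, h1, ← integral_smul]
        exact integral_congr_ae h2 }
    1 (by
      intro g
      rw [one_mul]
      show ‖(h.memLp g.1).toLp (fun x => ∫ y, g.1 y ∂κ x)‖ ≤ ‖g.1‖
      rw [Lp.norm_toLp, Lp.norm_def]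
      exact ENNReal.toReal_mono (Lp.memLp g.1).2.ne (h.eLpNorm_le (Lp.stronglyMeasurable g.1)))

end KernelOp

/-! ### Ordered eigenvalues, trace, trace-class operators -/

section Spectrum

variable {E : Type*} [NormedAddCommGroup E] [InnerProductSpace ℝ E]

/-- The ordered eigenvalues of a positive compact operator, repeated according to multiplicity and
counted from `0`: `eigenvalue T i` is the supremum (in fact the maximum) of the `r > 0` such that `T`
has `i + 1` linearly independent eigenvectors with eigenvalues at least `r`, and `0` if there is no
such `r`, that is, once the positive eigenvalues are exhausted. -/
noncomputable def eigenvalue (T : E →L[ℝ] E) (i : ℕ) : ℝ :=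
  sSup {r : ℝ | 0 < r ∧ ∃ v : Fin (i + 1) → E, LinearIndependent ℝ v ∧
    ∀ j, ∃ s, r ≤ s ∧ T (v j) = s • v j}

/-- The trace of a positive compact operator: the sum of its eigenvalues. -/
noncomputable def trace (T : E →L[ℝ] E) : ℝ := ∑' i, eigenvalue T i

/-- `T` is a positive trace-class operator: it is positive (in particular self-adjoint) and compact,
and the sum of its eigenvalues is finite. -/
structure IsPositiveTraceClass (T : E →L[ℝ] E) : Prop where
  isPositive : T.IsPositive
  isCompact : IsCompactOperator T
  summable_eigenvalue : Summable (eigenvalue T)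

end Spectrum

/-! ### The data augmentation and sandwich chains -/

section Chains

variable {X Y : Type*} [MeasurableSpace X] [MeasurableSpace Y]

/-- A joint probability density `f : X × Y → [0, ∞)` with respect to `μ × ν`. -/
structure JointDensity (μ : Measure X) (ν : Measure Y) where
  toFun : X → Y → ℝ≥0
  measurable_toFun : Measurable (Function.uncurry toFun)
  lintegral_eq_one : ∫⁻ x, ∫⁻ y, toFun x y ∂ν ∂μ = 1

namespace JointDensity

variable {μ : Measure X} {ν : Measure Y}

/-- The marginal density `f_X`. -/
noncomputable def fX (f : JointDensity μ ν) (x : X) : ℝ≥0∞ := ∫⁻ y, f.toFun x y ∂ν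

/-- The marginal density `f_Y`. -/
noncomputable def fY (f : JointDensity μ ν) (y : Y) : ℝ≥0∞ := ∫⁻ x, f.toFun x y ∂μ

/-- The conditional density `f_{X|Y}(x | y)`. -/
noncomputable def fXgY (f : JointDensity μ ν) (x : X) (y : Y) : ℝ≥0∞ := f.toFun x y / f.fY y

/-- The conditional density `f_{Y|X}(y | x)`. -/
noncomputable def fYgX (f : JointDensity μ ν) (y : Y) (x : X) : ℝ≥0∞ := f.toFun x y / f.fX x

/-- The target law `f_X(x) μ(dx)`. -/
noncomputable def lawX (f : JointDensity μ ν) : Measure X := μ.withDensity f.fX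

/-- The law `f_Y(y) ν(dy)`. -/
noncomputable def lawY (f : JointDensity μ ν) : Measure Y := ν.withDensity f.fY

/-- The transition density `k(x' | x) = ∫ f_{X|Y}(x' | y) f_{Y|X}(y | x) ν(dy)` of the data
augmentation chain. -/
noncomputable def daDensity (f : JointDensity μ ν) (x x' : X) : ℝ≥0∞ :=
  ∫⁻ y, f.fXgY x' y * f.fYgX y x ∂ν

/-- The transition density
`k*(x' | x) = ∫ (∫ f_{X|Y}(x' | y') R(y, dy')) f_{Y|X}(y | x) ν(dy)` of the sandwich chain. -/
noncomputable def sandwichDensity (f : JointDensity μ ν) (R : Kernel Y Y) (x x' : X) : ℝ≥0∞ :=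
  ∫⁻ y, (∫⁻ y', f.fXgY x' y' ∂(R y)) * f.fYgX y x ∂ν

/-- The transition function of the data augmentation chain. -/
noncomputable def daKernel (f : JointDensity μ ν) [SFinite μ] : Kernel X X :=
  (Kernel.const X μ).withDensity f.daDensity

/-- The transition function of the sandwich chain. -/
noncomputable def sandwichKernel (f : JointDensity μ ν) [SFinite μ] (R : Kernel Y Y) :
    Kernel X X :=
  (Kernel.const X μ).withDensity (f.sandwichDensity R)

/-- The transition function `f_{X|Y}(x | y) μ(dx)`. -/
noncomputable def kernelXgY (f : JointDensity μ ν) [SFinite μ] : Kernel Y X :=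
  (Kernel.const Y μ).withDensity (fun y x => f.fXgY x y)

/-- The transition function `f_{Y|X}(y | x) ν(dy)`. -/
noncomputable def kernelYgX (f : JointDensity μ ν) [SFinite ν] : Kernel X Y :=
  (Kernel.const X ν).withDensity (fun x y => f.fYgX y x)

theorem measurable_coe (f : JointDensity μ ν) :
    Measurable (fun p : X × Y => (f.toFun p.1 p.2 : ℝ≥0∞)) :=
  f.measurable_toFun.coe_nnreal_ennreal

theorem measurable_fX [SFinite ν] (f : JointDensity μ ν) : Measurable f.fX :=
  f.measurable_coe.lintegral_prod_right'

theorem measurable_fY [SFinite μ] (f : JointDensity μ ν) : Measurable f.fY :=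
  f.measurable_coe.lintegral_prod_left'

theorem measurable_fXgY [SFinite μ] (f : JointDensity μ ν) :
    Measurable (fun p : X × Y => f.fXgY p.1 p.2) :=
  f.measurable_coe.div (f.measurable_fY.comp measurable_snd)

theorem measurable_fYgX [SFinite ν] (f : JointDensity μ ν) :
    Measurable (fun p : X × Y => f.fYgX p.2 p.1) :=
  f.measurable_coe.div (f.measurable_fX.comp measurable_fst)

theorem measurable_daDensity [SFinite μ] [SFinite ν] (f : JointDensity μ ν) :
    Measurable (Function.uncurry f.daDensity) := by
  have h1 : Measurable (fun q : (X × X) × Y => f.fXgY q.1.2 q.2) :=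
    f.measurable_fXgY.comp (measurable_fst.snd.prodMk measurable_snd)
  have h2 : Measurable (fun q : (X × X) × Y => f.fYgX q.2 q.1.1) :=
    f.measurable_fYgX.comp (measurable_fst.fst.prodMk measurable_snd)
  exact (h1.mul h2).lintegral_prod_right'

theorem measurable_lintegral_fXgY [SFinite μ] (f : JointDensity μ ν) (R : Kernel Y Y)
    [IsSFiniteKernel R] : Measurable (fun p : X × Y => ∫⁻ y', f.fXgY p.1 y' ∂(R p.2)) := by
  have h1 : Measurable (fun q : (X × Y) × Y => f.fXgY q.1.1 q.2) :=
    f.measurable_fXgY.comp (measurable_fst.fst.prodMk measurable_snd)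
  exact h1.lintegral_kernel_prod_right' (κ := R.comap Prod.snd measurable_snd)

theorem measurable_sandwichDensity [SFinite μ] [SFinite ν] (f : JointDensity μ ν)
    (R : Kernel Y Y) [IsSFiniteKernel R] :
    Measurable (Function.uncurry (f.sandwichDensity R)) := by
  have h1 : Measurable (fun q : (X × X) × Y => ∫⁻ y', f.fXgY q.1.2 y' ∂(R q.2)) :=
    (f.measurable_lintegral_fXgY R).comp (measurable_fst.snd.prodMk measurable_snd)
  have h2 : Measurable (fun q : (X × X) × Y => f.fYgX q.2 q.1.1) :=
    f.measurable_fYgX.comp (measurable_fst.fst.prodMk measurable_snd)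
  exact (h1.mul h2).lintegral_prod_right'

theorem lintegral_fX (f : JointDensity μ ν) : ∫⁻ x, f.fX x ∂μ = 1 := f.lintegral_eq_one

theorem lintegral_fY [SFinite μ] [SFinite ν] (f : JointDensity μ ν) : ∫⁻ y, f.fY y ∂ν = 1 := by
  rw [← f.lintegral_eq_one]
  exact (lintegral_lintegral_swap f.measurable_coe.aemeasurable).symm

instance isProbabilityMeasure_lawX (f : JointDensity μ ν) : IsProbabilityMeasure f.lawX :=
  ⟨by rw [lawX, withDensity_apply _ MeasurableSet.univ, setLIntegral_univ]; exact f.lintegral_fX⟩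

instance isProbabilityMeasure_lawY [SFinite μ] [SFinite ν] (f : JointDensity μ ν) :
    IsProbabilityMeasure f.lawY :=
  ⟨by rw [lawY, withDensity_apply _ MeasurableSet.univ, setLIntegral_univ]; exact f.lintegral_fY⟩

theorem kernelYgX_apply [SFinite ν] (f : JointDensity μ ν) (x : X) :
    f.kernelYgX x = ν.withDensity (fun y => f.fYgX y x) :=
  Kernel.withDensity_apply _ f.measurable_fYgX x

theorem kernelXgY_apply [SFinite μ] (f : JointDensity μ ν) (y : Y) :
    f.kernelXgY y = μ.withDensity (fun x => f.fXgY x y) :=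
  Kernel.withDensity_apply (κ := Kernel.const Y μ) (f := fun y x => f.fXgY x y)
    (hf := f.measurable_fXgY.comp measurable_swap) y

/-- `f(x, y) = f_{Y|X}(y | x) f_X(x)` for almost every `y`, unless `f_X(x) = ∞`. -/
theorem fX_mul_fYgX (f : JointDensity μ ν) [SFinite ν] {x : X} (hx : f.fX x ≠ ∞) :
    ∀ᵐ y ∂ν, f.fX x * f.fYgX y x = f.toFun x y := by
  rcases eq_or_ne (f.fX x) 0 with h0 | h0
  · have hm : Measurable (fun y => (f.toFun x y : ℝ≥0∞)) := f.measurable_coe.comp measurable_prodMk_left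
    have h1 : (fun y => (f.toFun x y : ℝ≥0∞)) =ᵐ[ν] 0 := (lintegral_eq_zero_iff hm).1 h0
    filter_upwards [h1] with y hy
    rw [h0, zero_mul]
    exact hy.symm
  · exact ae_of_all _ fun y => ENNReal.mul_div_cancel h0 hx

theorem fY_mul_fXgY (f : JointDensity μ ν) [SFinite μ] {y : Y} (hy : f.fY y ≠ ∞) :
    ∀ᵐ x ∂μ, f.fY y * f.fXgY x y = f.toFun x y := by
  rcases eq_or_ne (f.fY y) 0 with h0 | h0
  · have hm : Measurable (fun x => (f.toFun x y : ℝ≥0∞)) := f.measurable_coe.comp measurable_prodMk_right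
    have h1 : (fun x => (f.toFun x y : ℝ≥0∞)) =ᵐ[μ] 0 := (lintegral_eq_zero_iff hm).1 h0
    filter_upwards [h1] with x hx
    rw [h0, zero_mul]
    exact hx.symm
  · exact ae_of_all _ fun x => ENNReal.mul_div_cancel h0 hy

theorem transports_kernelYgX [SFinite μ] [SFinite ν] (f : JointDensity μ ν) :
    Transports f.kernelYgX f.lawX f.lawY where
  mass_le_one x := by
    rw [kernelYgX_apply, withDensity_apply _ MeasurableSet.univ, setLIntegral_univ]
    have hm : Measurable (fun y => (f.toFun x y : ℝ≥0∞)) := f.measurable_coe.comp measurable_prodMk_left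
    simp only [fYgX, div_eq_mul_inv]
    rw [lintegral_mul_const _ hm]
    exact ENNReal.mul_inv_le_one _
  bind_eq := by
    ext s hs
    rw [Measure.bind_apply hs f.kernelYgX.measurable.aemeasurable, lawX,
      lintegral_withDensity_eq_lintegral_mul _ f.measurable_fX (f.kernelYgX.measurable_coe hs),
      lawY, withDensity_apply _ hs]
    have hfin : ∀ᵐ x ∂μ, f.fX x ≠ ∞ := by
      filter_upwards [ae_lt_top f.measurable_fX (by rw [f.lintegral_fX]; simp)] with x hx
      exact hx.ne
    calc ∫⁻ x, f.fX x * f.kernelYgX x s ∂μ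
        = ∫⁻ x, ∫⁻ y in s, f.toFun x y ∂ν ∂μ := by
          refine lintegral_congr_ae ?_
          filter_upwards [hfin] with x hx
          have hm : Measurable (fun y => f.fYgX y x) :=
            f.measurable_fYgX.comp measurable_prodMk_left
          rw [kernelYgX_apply, withDensity_apply _ hs, ← lintegral_const_mul _ hm]
          exact lintegral_congr_ae (ae_restrict_of_ae (f.fX_mul_fYgX hx))
      _ = ∫⁻ y in s, f.fY y ∂ν := lintegral_lintegral_swap f.measurable_coe.aemeasurable

theorem transports_kernelXgY [SFinite μ] [SFinite ν] (f : JointDensity μ ν) :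
    Transports f.kernelXgY f.lawY f.lawX where
  mass_le_one y := by
    rw [kernelXgY_apply, withDensity_apply _ MeasurableSet.univ, setLIntegral_univ]
    have hm : Measurable (fun x => (f.toFun x y : ℝ≥0∞)) := f.measurable_coe.comp measurable_prodMk_right
    simp only [fXgY, div_eq_mul_inv]
    rw [lintegral_mul_const _ hm]
    exact ENNReal.mul_inv_le_one _
  bind_eq := by
    ext s hs
    rw [Measure.bind_apply hs f.kernelXgY.measurable.aemeasurable, lawY,
      lintegral_withDensity_eq_lintegral_mul _ f.measurable_fY (f.kernelXgY.measurable_coe hs),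
      lawX, withDensity_apply _ hs]
    have hfin : ∀ᵐ y ∂ν, f.fY y ≠ ∞ := by
      filter_upwards [ae_lt_top f.measurable_fY (by rw [f.lintegral_fY]; simp)] with y hy
      exact hy.ne
    calc ∫⁻ y, f.fY y * f.kernelXgY y s ∂ν
        = ∫⁻ y, ∫⁻ x in s, f.toFun x y ∂μ ∂ν := by
          refine lintegral_congr_ae ?_
          filter_upwards [hfin] with y hy
          have hm : Measurable (fun x => f.fXgY x y) := f.measurable_fXgY.comp measurable_prodMk_right
          rw [kernelXgY_apply, withDensity_apply _ hs, ← lintegral_const_mul _ hm]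
          exact lintegral_congr_ae (ae_restrict_of_ae (f.fY_mul_fXgY hy))
      _ = ∫⁻ x in s, f.fX x ∂μ :=
          (lintegral_lintegral_swap f.measurable_coe.aemeasurable).symm

theorem daKernel_eq_comp [SFinite μ] [SFinite ν] (f : JointDensity μ ν) :
    f.daKernel = f.kernelXgY ∘ₖ f.kernelYgX := by
  ext x s hs
  rw [Kernel.comp_apply' _ _ _ hs, daKernel,
    Kernel.withDensity_apply' _ f.measurable_daDensity, Kernel.const_apply, kernelYgX_apply,
    lintegral_withDensity_eq_lintegral_mul (f := fun y => f.fYgX y x) _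
      (f.measurable_fYgX.comp measurable_prodMk_left)
      (f.kernelXgY.measurable_coe hs)]
  have hm : Measurable (fun q : X × Y => f.fXgY q.1 q.2 * f.fYgX q.2 x) :=
    f.measurable_fXgY.mul (f.measurable_fYgX.comp (measurable_const.prodMk measurable_snd))
  simp only [daDensity]
  rw [lintegral_lintegral_swap hm.aemeasurable]
  refine lintegral_congr fun y => ?_
  have hm' : Measurable (fun x => f.fXgY x y) := f.measurable_fXgY.comp measurable_prodMk_right
  rw [lintegral_mul_const _ hm', Pi.mul_apply, kernelXgY_apply, withDensity_apply _ hs, mul_comm]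

theorem sandwichKernel_eq_comp [SFinite μ] [SFinite ν] (f : JointDensity μ ν) (R : Kernel Y Y)
    [IsSFiniteKernel R] :
    f.sandwichKernel R = f.kernelXgY ∘ₖ (R ∘ₖ f.kernelYgX) := by
  rw [← Kernel.comp_assoc]
  ext x s hs
  rw [Kernel.comp_apply' _ _ _ hs, sandwichKernel,
    Kernel.withDensity_apply' _ (f.measurable_sandwichDensity R), Kernel.const_apply,
    kernelYgX_apply,
    lintegral_withDensity_eq_lintegral_mul (f := fun y => f.fYgX y x) _
      (f.measurable_fYgX.comp measurable_prodMk_left)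
      ((f.kernelXgY ∘ₖ R).measurable_coe hs)]
  have hm : Measurable (fun q : X × Y => (∫⁻ y', f.fXgY q.1 y' ∂(R q.2)) * f.fYgX q.2 x) :=
    (f.measurable_lintegral_fXgY R).mul
      (f.measurable_fYgX.comp (measurable_const.prodMk measurable_snd))
  simp only [sandwichDensity]
  rw [lintegral_lintegral_swap hm.aemeasurable]
  refine lintegral_congr fun y => ?_
  have hm' : Measurable (fun x => ∫⁻ y', f.fXgY x y' ∂(R y)) :=
    (f.measurable_lintegral_fXgY R).comp measurable_prodMk_right
  rw [lintegral_mul_const _ hm', Pi.mul_apply, Kernel.comp_apply' _ _ _ hs, mul_comm,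
    lintegral_lintegral_swap f.measurable_fXgY.aemeasurable]
  congr 1
  refine lintegral_congr fun y' => ?_
  rw [kernelXgY_apply, withDensity_apply _ hs]

theorem transports_of_isReversible [SFinite μ] [SFinite ν] (f : JointDensity μ ν)
    {R : Kernel Y Y} [IsMarkovKernel R] (hR : R.IsReversible f.lawY) :
    Transports R f.lawY f.lawY where
  mass_le_one y := by simp
  bind_eq := hR.invariant

theorem transports_daKernel [SFinite μ] [SFinite ν] (f : JointDensity μ ν) :
    Transports f.daKernel f.lawX f.lawX := by
  rw [daKernel_eq_comp]
  exact f.transports_kernelXgY.comp f.transports_kernelYgX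

theorem transports_sandwichKernel [SFinite μ] [SFinite ν] (f : JointDensity μ ν)
    {R : Kernel Y Y} [IsMarkovKernel R] (hR : R.IsReversible f.lawY) :
    Transports (f.sandwichKernel R) f.lawX f.lawX := by
  rw [sandwichKernel_eq_comp]
  exact f.transports_kernelXgY.comp
    ((f.transports_of_isReversible hR).comp f.transports_kernelYgX)

/-- The Markov operator `K` of the data augmentation chain on `L²₀(f_X)`:
`(K g)(x) = ∫ g(x') k(x' | x) μ(dx')`. -/
noncomputable def opK [SFinite μ] [SFinite ν] (f : JointDensity μ ν) :
    L20 f.lawX →L[ℝ] L20 f.lawX :=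
  kernelOp f.daKernel f.lawX f.lawX f.transports_daKernel

/-- The Markov operator `R` on `L²₀(f_Y)` of a Markov transition function reversible with respect
to `f_Y(y) ν(dy)`. -/
noncomputable def opR [SFinite μ] [SFinite ν] (f : JointDensity μ ν) (R : Kernel Y Y)
    [IsMarkovKernel R] (hR : R.IsReversible f.lawY) : L20 f.lawY →L[ℝ] L20 f.lawY :=
  kernelOp R f.lawY f.lawY (f.transports_of_isReversible hR)

/-- The Markov operator `K*` of the sandwich chain on `L²₀(f_X)`. -/
noncomputable def opKstar [SFinite μ] [SFinite ν] (f : JointDensity μ ν) (R : Kernel Y Y)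
    [IsMarkovKernel R] (hR : R.IsReversible f.lawY) : L20 f.lawX →L[ℝ] L20 f.lawX :=
  kernelOp (f.sandwichKernel R) f.lawX f.lawX (f.transports_sandwichKernel hR)

/-- The condition `∫∫ f_{X|Y}(x | y) f_{Y|X}(y | x) ν(dy) μ(dx) < ∞`. -/
def TraceCondition (f : JointDensity μ ν) : Prop :=
  ∫⁻ x, ∫⁻ y, f.fXgY x y * f.fYgX y x ∂ν ∂μ < ∞

/-- A singular value decomposition of `f`:
`f(x, y) / (f_X(x) f_Y(y)) = 1 + ∑ᵢ βᵢ gᵢ(x) hᵢ(y)`, with convergence in `L²(f_X × f_Y)`.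
The leading singular value `1`, with the constant singular functions `1`, is written separately, so
that the remaining singular functions lie in `L²₀(f_X)` and `L²₀(f_Y)`; these are counted from `0`
(`β i`, `g i`, `h i` are the usual `β_{i+1}`, `g_{i+1}`, `h_{i+1}`). The singular values decrease and
the singular functions belonging to positive singular values are orthonormal. A sequence with only
finitely many positive singular values is continued by zeros, and then the functions attached to
these zeros are arbitrary. In particular complete orthonormal systems are allowed, but completeness
is not demanded: if infinitely many singular values are positive and one of the operators has a
kernel, no sequence ordered by decreasing singular values is complete. -/
structure IsSVD [SFinite μ] [SFinite ν] (f : JointDensity μ ν) (β : ℕ → ℝ) (g : ℕ → L20 f.lawX)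
    (h : ℕ → L20 f.lawY) : Prop where
  mem_Icc : ∀ i, β i ∈ Set.Icc (0 : ℝ) 1
  antitone : Antitone β
  orthonormal_left : Orthonormal ℝ (fun i : {i : ℕ // 0 < β i} => g i)
  orthonormal_right : Orthonormal ℝ (fun i : {i : ℕ // 0 < β i} => h i)
  expansion : Tendsto (fun n : ℕ => eLpNorm (fun p : X × Y =>
    ((f.toFun p.1 p.2 : ℝ≥0∞) / (f.fX p.1 * f.fY p.2)).toReal
      - (1 + ∑ i ∈ Finset.range n, β i * (g i).1 p.1 * (h i).1 p.2))
    2 (f.lawX.prod f.lawY)) atTop (𝓝 0)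

end JointDensity

end Chains

end DataAugmentation

/-!
Let `A h = E[h(y) | x]` (`condOp`), a contraction `L²₀(f_Y) → L²₀(f_X)` whose adjoint is
`g ↦ E[g(x) | y]`. Then `K = A A†` and `K* = A R A†`, and `R`, being idempotent and self-adjoint by
reversibility, is an orthogonal projection, so that `K* = (A R) (A R)†`.

The trace condition says that the density `D = f / (f_X f_Y)` of the joint law relative to the
product of its marginals is in `L²`. Since `⟪D, u ⊗ v⟫ = ⟪u, A v⟫`, this makes `A` a Hilbert–Schmidt
operator; in particular it is compact and has a singular value decomposition
(`exists_isSingularSystem`). As product functions are total in `L²` of the product law, the singular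
value decompositions of `f` are precisely those of `A` (`IsSVD.isSingularSystem`,
`TraceCondition.isSVD`), and Bessel's inequality gives `∑ βᵢ² ≤ ‖D‖²`.

If `A` has singular values `βᵢ` and right singular vectors `hᵢ`, and `A R` has singular values `γⱼ`
and right singular vectors `vⱼ`, then the ordered eigenvalues of `K` and `K*` are `βᵢ²` and `γⱼ²`
(`IsSingularSystem.eigenvalue_eq`), and `K* ≤ K` gives `γᵢ² ≤ βᵢ²` by Weyl's monotonicity principle
(`IsSingularSystem.le_of_inner_le`). Each `vⱼ` is fixed by `R`, so expanding
`γⱼ² = ‖A vⱼ‖² = ∑ᵢ βᵢ² ⟪R hᵢ, vⱼ⟫²` and summing over `j` gives `tr K* ≤ ∑ᵢ βᵢ² ‖R hᵢ‖²`. Hence equal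
traces force `R hᵢ = hᵢ` (`IsSingularSystem.apply_right_eq_of_tsum_eq`); conversely, if every `hᵢ` is
fixed then `A R = A`. Finally `‖K*‖ = γ₀²` equals `‖K‖ = β₀²` precisely if `‖A ·‖` attains its norm at
a unit vector fixed by `R`, and it attains it only on the span of the top right singular vectors
(`IsSingularSystem.lt_iff_of_comp`).
-/

namespace DataAugmentation

/-! ### Singular systems -/

section SingularSystem

open ContinuousLinearMap InnerProductSpace

variable {E F : Type*} [NormedAddCommGroup E] [InnerProductSpace ℝ E]
  [NormedAddCommGroup F] [InnerProductSpace ℝ F]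

local notation "⟪" x ", " y "⟫" => inner ℝ x y

/-- `A = ∑ᵢ βᵢ gᵢ ⟨hᵢ, ·⟩` with convergence in the weak operator topology, where `β` is nonnegative
and decreasing and the vectors belonging to positive `βᵢ` are orthonormal on either side. The vectors
attached to `βᵢ = 0` are unrestricted. An eigenvalue expansion of a positive operator `T` is the case
`IsSingularSystem T β e e`. -/
structure IsSingularSystem (A : F →L[ℝ] E) (β : ℕ → ℝ) (g : ℕ → E) (h : ℕ → F) : Prop where
  nonneg : ∀ i, 0 ≤ β i
  antitone : Antitone β
  orthonormal_left : Orthonormal ℝ (fun i : {i : ℕ // 0 < β i} => g i)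
  orthonormal_right : Orthonormal ℝ (fun i : {i : ℕ // 0 < β i} => h i)
  expansion : ∀ x z, Tendsto (fun n => ∑ i ∈ Finset.range n, β i * ⟪g i, x⟫ * ⟪h i, z⟫) atTop
    (𝓝 ⟪x, A z⟫)

theorem inner_eq_ite_of_orthonormal_pos {β : ℕ → ℝ} {g : ℕ → E}
    (hg : Orthonormal ℝ (fun i : {i : ℕ // 0 < β i} => g i)) {i j : ℕ} (hi : 0 < β i)
    (hj : 0 < β j) : ⟪g i, g j⟫ = if i = j then 1 else 0 := by
  have := orthonormal_iff_ite.1 hg ⟨i, hi⟩ ⟨j, hj⟩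
  simpa using this

theorem orthonormal_fin_of_pos {β : ℕ → ℝ} {g : ℕ → E}
    (hg : Orthonormal ℝ (fun i : {i : ℕ // 0 < β i} => g i)) {n : ℕ} (hn : ∀ i < n, 0 < β i) :
    Orthonormal ℝ (fun i : Fin n => g i) :=
  hg.comp (fun i : Fin n => ⟨i, hn i i.2⟩) fun a b hab => by simpa [Fin.ext_iff] using hab

/-- Bessel's inequality for the vectors belonging to positive `βᵢ`, among the first `n`. -/
theorem sum_range_ite_inner_sq_le {β : ℕ → ℝ} {g : ℕ → E}
    (hg : Orthonormal ℝ (fun i : {i : ℕ // 0 < β i} => g i)) (n : ℕ) (x : E) :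
    ∑ i ∈ Finset.range n, (if 0 < β i then ⟪g i, x⟫ ^ 2 else 0) ≤ ‖x‖ ^ 2 := by
  have := hg.sum_inner_products_le (s := (Finset.range n).subtype (fun i => 0 < β i)) x
  rw [← Finset.sum_filter, ← Finset.sum_subtype_eq_sum_filter]
  simpa using this

namespace IsSingularSystem

variable {A : F →L[ℝ] E} {β : ℕ → ℝ} {g : ℕ → E} {h : ℕ → F}

theorem mul_inner_left (S : IsSingularSystem A β g h) {i : ℕ} (hi : 0 < β i) (j : ℕ) :
    β j * ⟪g j, g i⟫ = if j = i then β i else 0 := by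
  rcases (S.nonneg j).eq_or_lt with hj | hj
  · rw [← hj, zero_mul, if_neg]
    rintro rfl
    exact hi.ne hj
  · rw [inner_eq_ite_of_orthonormal_pos S.orthonormal_left hj hi]
    split_ifs with hij
    · rw [hij, mul_one]
    · rw [mul_zero]

theorem mul_inner_right (S : IsSingularSystem A β g h) {i : ℕ} (hi : 0 < β i) (j : ℕ) :
    β j * ⟪h j, h i⟫ = if j = i then β i else 0 := by
  rcases (S.nonneg j).eq_or_lt with hj | hj
  · rw [← hj, zero_mul, if_neg]
    rintro rfl
    exact hi.ne hj
  · rw [inner_eq_ite_of_orthonormal_pos S.orthonormal_right hj hi]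
    split_ifs with hij
    · rw [hij, mul_one]
    · rw [mul_zero]

theorem norm_left (S : IsSingularSystem A β g h) {i : ℕ} (hi : 0 < β i) : ‖g i‖ = 1 :=
  S.orthonormal_left.1 ⟨i, hi⟩

theorem norm_right (S : IsSingularSystem A β g h) {i : ℕ} (hi : 0 < β i) : ‖h i‖ = 1 :=
  S.orthonormal_right.1 ⟨i, hi⟩

theorem apply_right (S : IsSingularSystem A β g h) {i : ℕ} (hi : 0 < β i) :
    A (h i) = β i • g i := by
  refine ext_inner_left ℝ fun x => ?_
  refine tendsto_nhds_unique (S.expansion x (h i)) ?_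
  refine tendsto_const_nhds.congr' ?_
  filter_upwards [eventually_gt_atTop i] with n hn
  have : ∀ j ∈ Finset.range n, β j * ⟪g j, x⟫ * ⟪h j, h i⟫
      = if j = i then β i * ⟪g i, x⟫ else 0 := by
    intro j _
    rw [mul_right_comm, S.mul_inner_right hi]
    split_ifs with hji
    · rw [hji]
    · rw [zero_mul]
  rw [Finset.sum_congr rfl this, Finset.sum_ite_eq', if_pos (Finset.mem_range.2 hn),
    inner_smul_right, real_inner_comm]

/-- A singular system of `A` kills the orthogonal complement of its right singular vectors. -/
theorem apply_eq_zero (S : IsSingularSystem A β g h) {z : F} (hz : ∀ i, 0 < β i → ⟪h i, z⟫ = 0) :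
    A z = 0 := by
  refine ext_inner_left ℝ fun x => ?_
  refine tendsto_nhds_unique (S.expansion x z) ?_
  refine tendsto_const_nhds.congr fun n => ?_
  rw [inner_zero_right]
  refine (Finset.sum_eq_zero fun i _ => ?_).symm
  rcases (S.nonneg i).eq_or_lt with hi | hi
  · rw [← hi, zero_mul, zero_mul]
  · rw [hz i hi, mul_zero]

variable [CompleteSpace E] [CompleteSpace F]

theorem adjoint (S : IsSingularSystem A β g h) : IsSingularSystem (adjoint A) β h g where
  nonneg := S.nonneg
  antitone := S.antitone
  orthonormal_left := S.orthonormal_right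
  orthonormal_right := S.orthonormal_left
  expansion z x := by
    rw [adjoint_inner_right, real_inner_comm]
    simpa only [mul_right_comm] using S.expansion x z

/-- The squares of the singular values are the eigenvalues of `A A†`. -/
theorem comp_adjoint (S : IsSingularSystem A β g h) :
    IsSingularSystem (A ∘L ContinuousLinearMap.adjoint A) (fun i => β i ^ 2) g g := by
  have hpos : ∀ i, 0 < β i ^ 2 → 0 < β i := fun i hi =>
    (S.nonneg i).lt_of_ne fun h0 => by simp [← h0] at hi
  refine ⟨fun i => sq_nonneg _, fun i j hij => pow_le_pow_left₀ (S.nonneg j) (S.antitone hij) 2,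
    ?_, ?_, fun x y => ?_⟩
  · exact S.orthonormal_left.comp (fun i : {i : ℕ // 0 < β i ^ 2} => ⟨i, hpos i i.2⟩)
      fun i j hij => Subtype.ext (by simpa using hij)
  · exact S.orthonormal_left.comp (fun i : {i : ℕ // 0 < β i ^ 2} => ⟨i, hpos i i.2⟩)
      fun i j hij => Subtype.ext (by simpa using hij)
  · rw [comp_apply]
    refine (S.expansion x (ContinuousLinearMap.adjoint A y)).congr fun n => ?_
    refine Finset.sum_congr rfl fun i _ => ?_
    rcases (S.nonneg i).eq_or_lt with hi | hi
    · simp [← hi]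
    · rw [adjoint_inner_right, S.apply_right hi, real_inner_smul_left]
      ring

theorem hasSum_norm_sq (S : IsSingularSystem A β g h) (z : F) :
    HasSum (fun i => β i ^ 2 * ⟪h i, z⟫ ^ 2) (‖A z‖ ^ 2) := by
  rw [hasSum_iff_tendsto_nat_of_nonneg fun i => by positivity]
  have := S.adjoint.comp_adjoint.expansion z z
  rw [adjoint_adjoint, comp_apply, adjoint_inner_right, real_inner_self_eq_norm_sq] at this
  exact this.congr fun n => Finset.sum_congr rfl fun i _ => by ring

theorem norm_eq (S : IsSingularSystem A β g h) : ‖A‖ = β 0 := by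
  apply le_antisymm
  · refine A.opNorm_le_bound (S.nonneg 0) fun z => ?_
    refine le_of_sq_le_sq ?_ (mul_nonneg (S.nonneg 0) (norm_nonneg z))
    refine le_of_tendsto' (S.hasSum_norm_sq z).tendsto_sum_nat fun n => ?_
    calc ∑ i ∈ Finset.range n, β i ^ 2 * ⟪h i, z⟫ ^ 2
        ≤ ∑ i ∈ Finset.range n, β 0 ^ 2 * (if 0 < β i then ⟪h i, z⟫ ^ 2 else 0) := by
          refine Finset.sum_le_sum fun i _ => ?_
          split_ifs with hi
          · have := pow_le_pow_left₀ (S.nonneg i) (S.antitone (Nat.zero_le i)) 2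
            gcongr
          · rw [le_antisymm (not_lt.1 hi) (S.nonneg i)]
            simp
      _ ≤ β 0 ^ 2 * ‖z‖ ^ 2 := by
          rw [← Finset.mul_sum]
          exact mul_le_mul_of_nonneg_left (sum_range_ite_inner_sq_le S.orthonormal_right n z)
            (sq_nonneg _)
      _ = (β 0 * ‖z‖) ^ 2 := by ring
  · rcases (S.nonneg 0).eq_or_lt with h0 | h0
    · rw [← h0]
      exact norm_nonneg A
    · have := A.le_opNorm (h 0)
      rwa [S.apply_right h0, norm_smul, S.norm_left h0, S.norm_right h0, mul_one, mul_one,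
        Real.norm_of_nonneg h0.le] at this

end IsSingularSystem

/-! ### Eigenvalue expansions of positive operators -/

namespace IsSingularSystem

variable {T U : E →L[ℝ] E} {l m : ℕ → ℝ} {e d : ℕ → E}

/-- The numbers in an eigenvalue expansion are the ordered eigenvalues: an eigenvector whose
eigenvalue exceeds `lᵢ` lies in the span of `e₀, …, eᵢ₋₁`, so there are at most `i` independent
ones. -/
theorem eigenvalue_eq (S : IsSingularSystem T l e e) (i : ℕ) : eigenvalue T i = l i := by
  have hle : ∀ r ∈ {r : ℝ | 0 < r ∧ ∃ v : Fin (i + 1) → E, LinearIndependent ℝ v ∧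
      ∀ j, ∃ s, r ≤ s ∧ T (v j) = s • v j}, r ≤ l i := by
    rintro r ⟨hr, v, hv, hT⟩
    by_contra! hri
    have hmem : ∀ j, v j ∈ Submodule.span ℝ (Set.range fun k : Fin i => e k) := by
      intro j
      obtain ⟨s, hs, hTs⟩ := hT j
      have hs0 : 0 < s := hr.trans_le hs
      have hcoef : ∀ k, i ≤ k → l k * ⟪e k, v j⟫ = 0 := by
        intro k hk
        rcases (S.nonneg k).eq_or_lt with h0 | h0
        · rw [← h0, zero_mul]
        -- Evaluate `⟪e k, T (v j)⟫` through the expansion and through the eigenvalue equation.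
        have h1 : ⟪e k, T (v j)⟫ = l k * ⟪e k, v j⟫ := by
          refine tendsto_nhds_unique (S.expansion (e k) (v j)) ?_
          refine tendsto_const_nhds.congr' ?_
          filter_upwards [eventually_gt_atTop k] with n hn
          simp only [S.mul_inner_left h0, ite_mul, zero_mul]
          rw [Finset.sum_ite_eq', if_pos (Finset.mem_range.2 hn)]
        rw [hTs, inner_smul_right] at h1
        have h2 : l k < s := (S.antitone hk).trans_lt (hri.trans_le hs)
        have h3 : (s - l k) * ⟪e k, v j⟫ = 0 := by rw [sub_mul, h1, sub_self]
        rw [(mul_eq_zero.1 h3).resolve_left (sub_pos.2 h2).ne', mul_zero]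
      have hsv : s • v j = ∑ k : Fin i, (l k * ⟪e k, v j⟫) • e k := by
        rw [← hTs]
        refine ext_inner_left ℝ fun x => ?_
        refine tendsto_nhds_unique (S.expansion x (v j)) ?_
        refine tendsto_const_nhds.congr' ?_
        filter_upwards [eventually_ge_atTop i] with n hn
        rw [inner_sum, Fin.sum_univ_eq_sum_range (fun k => ⟪x, (l k * ⟪e k, v j⟫) • e k⟫) i]
        refine (Finset.sum_subset (Finset.range_mono hn) fun k _ hk => ?_).trans
          (Finset.sum_congr rfl fun k _ => ?_)
        · rw [hcoef k (by simpa using hk), zero_smul, inner_zero_right]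
        · rw [inner_smul_right, real_inner_comm x]
          ring
      have : v j = s⁻¹ • ∑ k : Fin i, (l k * ⟪e k, v j⟫) • e k := by
        rw [← hsv, inv_smul_smul₀ hs0.ne']
      rw [this]
      exact Submodule.smul_mem _ _ (Submodule.sum_mem _ fun k _ => Submodule.smul_mem _ _
        (Submodule.subset_span ⟨k, rfl⟩))
    have h1 : Module.finrank ℝ (Submodule.span ℝ (Set.range v)) = i + 1 := by
      simpa using finrank_span_eq_card hv
    have h2 : Module.finrank ℝ (Submodule.span ℝ (Set.range fun k : Fin i => e k)) ≤ i := by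
      simpa [Set.finrank] using finrank_range_le_card (R := ℝ) (fun k : Fin i => e k)
    have h3 : Submodule.span ℝ (Set.range v) ≤ Submodule.span ℝ (Set.range fun k : Fin i => e k) :=
      Submodule.span_le.2 (by rintro _ ⟨j, rfl⟩; exact hmem j)
    have := FiniteDimensional.span_of_finite ℝ (Set.finite_range fun k : Fin i => e k)
    have := Submodule.finrank_mono h3
    omega
  apply le_antisymm
  · exact Real.sSup_le hle (S.nonneg i)
  · rcases (S.nonneg i).eq_or_lt with h0 | h0
    · rw [← h0]
      exact Real.sSup_nonneg fun r hr => hr.1.le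
    · refine le_csSup ⟨l i, hle⟩ ⟨h0, fun j => e j, ?_, fun j => ⟨l j, ?_, ?_⟩⟩
      · exact (orthonormal_fin_of_pos S.orthonormal_left fun j hj =>
          h0.trans_le (S.antitone (Nat.lt_succ_iff.1 hj))).linearIndependent
      · exact S.antitone (Nat.lt_succ_iff.1 j.2)
      · exact S.apply_right (h0.trans_le (S.antitone (Nat.lt_succ_iff.1 j.2)))

/-- The upper half of the Courant–Fischer principle. -/
theorem inner_apply_le (S : IsSingularSystem T l e e) (i : ℕ) {x : E}
    (hx : ∀ j < i, ⟪e j, x⟫ = 0) : ⟪x, T x⟫ ≤ l i * ‖x‖ ^ 2 := by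
  refine le_of_tendsto' (S.expansion x x) fun n => ?_
  calc ∑ j ∈ Finset.range n, l j * ⟪e j, x⟫ * ⟪e j, x⟫
      ≤ ∑ j ∈ Finset.range n, l i * (if 0 < l j then ⟪e j, x⟫ ^ 2 else 0) := by
        refine Finset.sum_le_sum fun j _ => ?_
        rcases lt_or_ge j i with hj | hj
        · rw [hx j hj]
          have := S.nonneg i
          simp
        · split_ifs with hp
          · have := S.antitone hj
            rw [mul_assoc, ← sq]
            gcongr
          · rw [le_antisymm (not_lt.1 hp) (S.nonneg j)]
            simp
    _ ≤ l i * ‖x‖ ^ 2 := by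
        rw [← Finset.mul_sum]
        exact mul_le_mul_of_nonneg_left (sum_range_ite_inner_sq_le S.orthonormal_left n x)
          (S.nonneg i)

/-- The lower half of the Courant–Fischer principle. -/
theorem le_inner_apply (S : IsSingularSystem T l e e) {i : ℕ} (hi : 0 < l i) (a : Fin (i + 1) → ℝ) :
    l i * ‖∑ j, a j • e j‖ ^ 2 ≤ ⟪∑ j, a j • e j, T (∑ j, a j • e j)⟫ := by
  have hp : ∀ j : Fin (i + 1), 0 < l j := fun j =>
    hi.trans_le (S.antitone (Nat.lt_succ_iff.1 j.2))
  have ho : Orthonormal ℝ (fun j : Fin (i + 1) => e j) :=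
    orthonormal_fin_of_pos S.orthonormal_left fun j hj => hp ⟨j, hj⟩
  have hT : T (∑ j, a j • e j) = ∑ j : Fin (i + 1), (l j * a j) • e j := by
    rw [map_sum]
    refine Finset.sum_congr rfl fun j _ => ?_
    rw [map_smul, S.apply_right (hp j), smul_smul, mul_comm]
  rw [hT, ← real_inner_self_eq_norm_sq, ho.inner_sum, ho.inner_sum, Finset.mul_sum]
  refine Finset.sum_le_sum fun j _ => ?_
  have := S.antitone (Nat.lt_succ_iff.1 j.2)
  simp only [conj_trivial]
  nlinarith [mul_self_nonneg (a j)]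

/-- Weyl's monotonicity principle. -/
theorem le_of_inner_le (S : IsSingularSystem T l e e) (S' : IsSingularSystem U m d d)
    (hTU : ∀ x, ⟪x, T x⟫ ≤ ⟪x, U x⟫) (i : ℕ) : l i ≤ m i := by
  rcases (S.nonneg i).eq_or_lt with h0 | h0
  · rw [← h0]
    exact S'.nonneg i
  -- A nonzero combination of `e₀, …, eᵢ` orthogonal to `d₀, …, dᵢ₋₁` exists by counting dimensions.
  let L : (Fin (i + 1) → ℝ) →ₗ[ℝ] (Fin i → ℝ) :=
    { toFun := fun a k => ⟪d k, ∑ j, a j • e j⟫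
      map_add' := fun a b => by
        ext k
        simp [add_smul, Finset.sum_add_distrib, inner_add_right]
      map_smul' := fun c a => by
        ext k
        simp [mul_smul, ← Finset.smul_sum, inner_smul_right] }
  have hL : LinearMap.ker L ≠ ⊥ := LinearMap.ker_ne_bot_of_finrank_lt (by simp)
  obtain ⟨a, haL, ha0⟩ := (Submodule.ne_bot_iff _).1 hL
  have ho : ∀ k < i, ⟪d k, ∑ j, a j • e j⟫ = 0 := fun k hk => congrFun haL ⟨k, hk⟩
  have hli : LinearIndependent ℝ (fun j : Fin (i + 1) => e j) :=
    (orthonormal_fin_of_pos S.orthonormal_left fun j hj =>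
      h0.trans_le (S.antitone (Nat.lt_succ_iff.1 hj))).linearIndependent
  have hne : ∑ j, a j • e j ≠ 0 := fun h =>
    ha0 (funext fun j => Fintype.linearIndependent_iff.1 hli a h j)
  have h1 := (S.le_inner_apply h0 a).trans ((hTU _).trans (S'.inner_apply_le i ho))
  exact le_of_mul_le_mul_right h1 (by positivity)

end IsSingularSystem

end SingularSystem

/-! ### The spectral theorem for positive compact operators -/

section Existence

open ContinuousLinearMap InnerProductSpace

variable {E F : Type*} [NormedAddCommGroup E] [InnerProductSpace ℝ E]
  [NormedAddCommGroup F] [InnerProductSpace ℝ F]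

local notation "⟪" x ", " y "⟫" => inner ℝ x y

/-- Subtracting from a positive operator its part along a unit eigenvector leaves a positive
operator of no larger norm. -/
theorem isPositive_sub_rankOne {T : E →L[ℝ] E} (hT : T.IsPositive) {e : E} (he : ‖e‖ = 1)
    {c : ℝ} (hTe : T e = c • e) :
    (T - c • rankOne ℝ e e).IsPositive ∧ ‖T - c • rankOne ℝ e e‖ ≤ ‖T‖ := by
  have hee : ⟪e, e⟫ = 1 := by rw [real_inner_self_eq_norm_sq, he, one_pow]
  have hsymm : ∀ x y, ⟪T x, y⟫ = ⟪x, T y⟫ := hT.isSymmetric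
  refine ⟨(isPositive_iff _).2 ⟨fun x y => ?_, fun x => ?_⟩, ?_⟩
  · simp only [coe_coe, sub_apply, smul_apply, rankOne_apply, inner_sub_left, inner_sub_right,
      real_inner_smul_left, inner_smul_right, hsymm, real_inner_comm e]
    ring
  · have h1 := hT.inner_nonneg_left (x - ⟪e, x⟫ • e)
    have h2 : ⟪T x, e⟫ = c * ⟪e, x⟫ := by
      rw [hsymm, hTe, inner_smul_right, real_inner_comm]
    simp only [map_sub, map_smul, hTe, inner_sub_left, inner_sub_right,
      real_inner_smul_left, inner_smul_right, hee, h2] at h1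
    simp only [sub_apply, smul_apply, rankOne_apply, inner_sub_left, real_inner_smul_left]
    nlinarith
  · refine opNorm_le_bound _ (norm_nonneg T) fun x => ?_
    have h1 : (T - c • rankOne ℝ e e) x = T (x - ⟪e, x⟫ • e) := by
      rw [map_sub, map_smul, hTe, smul_comm]
      rfl
    have h2 : ‖x - ⟪e, x⟫ • e‖ ≤ ‖x‖ := by
      refine le_of_sq_le_sq ?_ (norm_nonneg x)
      rw [norm_sub_sq_real, inner_smul_right, norm_smul, he, real_inner_comm, mul_one,
        Real.norm_eq_abs, sq_abs]
      nlinarith [sq_nonneg ⟪e, x⟫]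
    rw [h1]
    exact (T.le_opNorm _).trans (by gcongr)

variable [CompleteSpace E]

/-- The norm of a nonzero positive compact operator is an eigenvalue. -/
theorem exists_unit_eigenvector {T : E →L[ℝ] E} (hT : T.IsPositive) (hc : IsCompactOperator T)
    (h0 : T ≠ 0) : ∃ e, ‖e‖ = 1 ∧ T e = ‖T‖ • e := by
  have hr : spectralRadius ℝ T = ‖T‖₊ := T.spectralRadius_eq_nnnorm hT.isSelfAdjoint
  have hn : (spectrum ℝ T).Nonempty := by
    by_contra hne
    rw [Set.not_nonempty_iff_eq_empty] at hne
    rw [spectralRadius, hne] at hr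
    exact h0 (nnnorm_eq_zero.1 (by simpa [eq_comm] using hr))
  obtain ⟨k, hk, hkn⟩ := spectrum.exists_nnnorm_eq_spectralRadius_of_nonempty hn
  have hkT : ‖k‖ = ‖T‖ := by
    rw [hr] at hkn
    exact congrArg NNReal.toReal (ENNReal.coe_injective hkn)
  have hk0 : k ≠ 0 := by
    rw [← norm_ne_zero_iff, hkT]
    exact norm_ne_zero_iff.2 h0
  obtain ⟨v, hv⟩ := ((hc.hasEigenvalue_iff_mem_spectrum hk0).2 hk).exists_hasEigenvector
  have hTv : T v = k • v := hv.apply_eq_smul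
  have hv0 : v ≠ 0 := hv.2
  have hkpos : 0 ≤ k := by
    have h1 := hT.inner_nonneg_left v
    rw [hTv, real_inner_smul_left, real_inner_self_eq_norm_sq] at h1
    exact nonneg_of_mul_nonneg_left h1 (by positivity)
  rw [Real.norm_of_nonneg hkpos] at hkT
  refine ⟨‖v‖⁻¹ • v, by simp [norm_smul, hv0], ?_⟩
  rw [map_smul, hTv, hkT, smul_comm]

/-- Repeated deflation of a positive compact operator: `T₀ = T`, and `Tₙ₊₁` is `Tₙ` without its part
along a top eigenvector `eₙ`. -/
theorem exists_deflation {T : E →L[ℝ] E} (hT : T.IsPositive) (hc : IsCompactOperator T) :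
    ∃ (Q : ℕ → E →L[ℝ] E) (e : ℕ → E), Q 0 = T ∧ (∀ n, (Q n).IsPositive) ∧
      (∀ n, ‖Q (n + 1)‖ ≤ ‖Q n‖) ∧ (∀ n, Q n = 0 → e n = 0) ∧ (∀ n, Q n ≠ 0 → ‖e n‖ = 1) ∧
      (∀ n, Q n (e n) = ‖Q n‖ • e n) ∧
      ∀ n, Q (n + 1) = Q n - ‖Q n‖ • rankOne ℝ (e n) (e n) := by
  have key : ∀ P : {P : E →L[ℝ] E // P.IsPositive ∧ IsCompactOperator P},
      ∃ e : E, (P.1 = 0 → e = 0) ∧ (P.1 ≠ 0 → ‖e‖ = 1) ∧ P.1 e = ‖P.1‖ • e := by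
    rintro ⟨P, hP, hPc⟩
    rcases eq_or_ne P 0 with h0 | h0
    · exact ⟨0, fun _ => rfl, fun h => absurd h0 h, by simp⟩
    · obtain ⟨e, he, hPe⟩ := exists_unit_eigenvector hP hPc h0
      exact ⟨e, fun h => absurd h h0, fun _ => he, hPe⟩
  choose v hv0 hv1 hv using key
  have hstep : ∀ P : {P : E →L[ℝ] E // P.IsPositive ∧ IsCompactOperator P},
      ((P.1 - ‖P.1‖ • rankOne ℝ (v P) (v P)).IsPositive ∧
        IsCompactOperator (P.1 - ‖P.1‖ • rankOne ℝ (v P) (v P))) ∧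
      ‖P.1 - ‖P.1‖ • rankOne ℝ (v P) (v P)‖ ≤ ‖P.1‖ := by
    intro P
    rcases eq_or_ne P.1 0 with h0 | h0
    · have : P.1 - ‖P.1‖ • rankOne ℝ (v P) (v P) = P.1 := by simp [h0]
      rw [this]
      exact ⟨P.2, le_rfl⟩
    · obtain ⟨h1, h2⟩ := isPositive_sub_rankOne P.2.1 (hv1 P h0) (hv P)
      refine ⟨⟨h1, ?_⟩, h2⟩
      have : P.1 - ‖P.1‖ • rankOne ℝ (v P) (v P)
          = P.1 ∘L (ContinuousLinearMap.id ℝ E - rankOne ℝ (v P) (v P)) := by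
        ext x
        simp only [sub_apply, smul_apply, rankOne_apply, comp_apply, id_apply, map_sub, map_smul,
          hv P]
        rw [smul_comm]
      rw [this]
      exact P.2.2.comp_clm _
  let step : {P : E →L[ℝ] E // P.IsPositive ∧ IsCompactOperator P} →
    {P : E →L[ℝ] E // P.IsPositive ∧ IsCompactOperator P} := fun P => ⟨_, (hstep P).1⟩
  let Q := fun n : ℕ => step^[n] ⟨T, hT, hc⟩
  have hQ : ∀ n, Q (n + 1) = step (Q n) := fun n => Function.iterate_succ_apply' _ _ _
  refine ⟨fun n => (Q n).1, fun n => v (Q n), rfl, fun n => (Q n).2.1, fun n => ?_,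
    fun n => hv0 _, fun n => hv1 _, fun n => hv _, fun n => ?_⟩
  · show ‖(Q (n + 1)).1‖ ≤ ‖(Q n).1‖
    rw [hQ]
    exact (hstep _).2
  · show (Q (n + 1)).1 = _
    rw [hQ]

/-- The **spectral theorem** for a positive compact operator, with the eigenvalues in decreasing
order. -/
theorem exists_isSingularSystem_of_isPositive {T : E →L[ℝ] E} (hT : T.IsPositive)
    (hc : IsCompactOperator T) :
    ∃ (l : ℕ → ℝ) (e : ℕ → E), IsSingularSystem T l e e ∧ ∀ i, l i = 0 → e i = 0 := by
  obtain ⟨Q, e, hQ0, hpos, hle, he0, he1, heig, hsucc⟩ := exists_deflation hT hc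
  have hsymm : ∀ n x y, ⟪Q n x, y⟫ = ⟪x, Q n y⟫ := fun n => (hpos n).isSymmetric
  have hunit : ∀ n, 0 < ‖Q n‖ → ‖e n‖ = 1 := fun n hn => he1 n (norm_pos_iff.1 hn)
  have hanti : Antitone fun n => ‖Q n‖ := antitone_nat_of_succ_le hle
  have hkill : ∀ i j, i < j → Q j (e i) = 0 := by
    intro i j hij
    induction j, hij using Nat.le_induction with
    | base =>
      rw [hsucc, sub_apply, smul_apply, rankOne_apply, heig, real_inner_self_eq_norm_sq]
      by_cases h0 : Q i = 0
      · simp [h0]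
      · rw [he1 i h0]
        simp
    | succ j hij ih =>
      have h1 : ‖Q j‖ * ⟪e j, e i⟫ = 0 := by
        rw [← real_inner_smul_left, ← heig, hsymm, ih, inner_zero_right]
      rw [hsucc, sub_apply, smul_apply, rankOne_apply, ih, smul_smul, h1]
      simp
  have horth : ∀ i j, i < j → ‖Q j‖ * ⟪e j, e i⟫ = 0 := fun i j hij => by
    rw [← real_inner_smul_left, ← heig, hsymm, hkill i j hij, inner_zero_right]
  have hon : Orthonormal ℝ (fun i : {i : ℕ // 0 < ‖Q i‖} => e i) := by
    refine ⟨fun i => hunit i i.2, fun i j hij => ?_⟩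
    rcases lt_or_gt_of_ne (fun h => hij (Subtype.ext h) : (i : ℕ) ≠ j) with h | h
    · rw [real_inner_comm]
      exact (mul_eq_zero.1 (horth i j h)).resolve_left j.2.ne'
    · exact (mul_eq_zero.1 (horth j i h)).resolve_left i.2.ne'
  have hexp : ∀ n x, T x = Q n x + ∑ j ∈ Finset.range n, (‖Q j‖ * ⟪e j, x⟫) • e j := by
    intro n x
    induction n with
    | zero => simp [hQ0]
    | succ n ih =>
      rw [ih, Finset.sum_range_succ, hsucc, sub_apply, smul_apply, rankOne_apply, smul_smul]
      abel
  have hlim : Tendsto (fun n => ‖Q n‖) atTop (𝓝 0) := by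
    have hbdd : BddBelow (Set.range fun n => ‖Q n‖) := ⟨0, by rintro _ ⟨n, rfl⟩; exact norm_nonneg _⟩
    have ht := tendsto_atTop_ciInf hanti hbdd
    have hc0 : 0 ≤ ⨅ n, ‖Q n‖ := le_ciInf fun n => norm_nonneg _
    rcases hc0.eq_or_lt with h0 | h0
    · rwa [← h0] at ht
    exfalso
    have hge : ∀ n, ⨅ n, ‖Q n‖ ≤ ‖Q n‖ := fun n => ciInf_le hbdd n
    have hpos' : ∀ n, 0 < ‖Q n‖ := fun n => h0.trans_le (hge n)
    -- Otherwise the vectors `T eₙ = ‖Tₙ‖ eₙ` are orthogonal and bounded below in norm, so that no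
    -- subsequence converges.
    have hTe : ∀ n, T (e n) = ‖Q n‖ • e n := by
      intro n
      rw [hexp n, heig, Finset.sum_eq_zero, add_zero]
      intro j hj
      have := (mul_eq_zero.1 (horth j n (Finset.mem_range.1 hj))).resolve_left (hpos' n).ne'
      rw [real_inner_comm, this, mul_zero, zero_smul]
    obtain ⟨K, hK, hKsub⟩ := hc.image_closedBall_subset_compact (f := T.toLinearMap) 1
    obtain ⟨a, -, φ, hφ, ha⟩ := hK.tendsto_subseq (x := fun n => T (e n)) fun n =>
      hKsub ⟨e n, by simp [hunit n (hpos' n)], rfl⟩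
    have h1 : Tendsto (fun n => T (e (φ (n + 1))) - T (e (φ n))) atTop (𝓝 (a - a)) :=
      ((tendsto_add_atTop_iff_nat 1).2 ha).sub ha
    rw [sub_self] at h1
    have h2 := (h1.norm.pow 2)
    rw [norm_zero, zero_pow two_ne_zero] at h2
    have h3 : ∀ n, (⨅ n, ‖Q n‖) ^ 2 ≤ ‖T (e (φ (n + 1))) - T (e (φ n))‖ ^ 2 := by
      intro n
      have ho := (mul_eq_zero.1 (horth (φ n) (φ (n + 1)) (hφ n.lt_succ_self))).resolve_left
        (hpos' _).ne'
      rw [hTe, hTe, norm_sub_sq_real, inner_smul_right, real_inner_smul_left, ho, norm_smul,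
        norm_smul, hunit _ (hpos' _), hunit _ (hpos' _), norm_norm, norm_norm]
      nlinarith [pow_le_pow_left₀ h0.le (hge (φ n)) 2, sq_nonneg ‖Q (φ (n + 1))‖]
    have h4 := ge_of_tendsto' h2 h3
    have : 0 < (⨅ n, ‖Q n‖) ^ 2 := by positivity
    exact absurd h4 (not_le.2 this)
  refine ⟨fun n => ‖Q n‖, e, ⟨fun n => norm_nonneg _, hanti, hon, hon, fun x y => ?_⟩,
    fun n hn => he0 n (norm_eq_zero.1 hn)⟩
  have h1 : Tendsto (fun n => ⟪x, Q n y⟫) atTop (𝓝 0) := by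
    refine squeeze_zero_norm (a := fun n => ‖x‖ * (‖Q n‖ * ‖y‖)) (fun n => ?_) ?_
    · exact (norm_inner_le_norm _ _).trans (by gcongr; exact le_opNorm _ _)
    · simpa using (hlim.mul_const ‖y‖).const_mul ‖x‖
  have h2 : Tendsto (fun n => ⟪x, T y⟫ - ⟪x, Q n y⟫) atTop (𝓝 ⟪x, T y⟫) := by
    simpa using h1.const_sub ⟪x, T y⟫
  refine h2.congr fun n => ?_
  rw [hexp n y, inner_add_right, add_sub_cancel_left, inner_sum]
  refine Finset.sum_congr rfl fun j _ => ?_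
  rw [inner_smul_right, real_inner_comm x]
  ring

/-- Every compact operator between Hilbert spaces has a singular value decomposition. -/
theorem exists_isSingularSystem [CompleteSpace F] {A : F →L[ℝ] E} (hA : IsCompactOperator A) :
    ∃ (β : ℕ → ℝ) (g : ℕ → E) (h : ℕ → F), IsSingularSystem A β g h := by
  obtain ⟨l, g, S, hg0⟩ := exists_isSingularSystem_of_isPositive (isPositive_self_comp_adjoint A)
    (hA.comp_clm (adjoint A))
  have hsq : ∀ i, √(l i) ^ 2 = l i := fun i => Real.sq_sqrt (S.nonneg i)
  have hlp : ∀ i, 0 < √(l i) → 0 < l i := fun i => Real.sqrt_pos.1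
  have hgn : ∀ i j, 0 < l i → ⟪g i, g j⟫ = if i = j then 1 else 0 := by
    intro i j hi
    rcases (S.nonneg j).eq_or_lt with hj | hj
    · rw [hg0 j hj.symm, inner_zero_right, if_neg]
      rintro rfl
      exact hi.ne hj
    · exact inner_eq_ite_of_orthonormal_pos S.orthonormal_left hi hj
  refine ⟨fun i => √(l i), g, fun i => (√(l i))⁻¹ • adjoint A (g i), fun i => Real.sqrt_nonneg _,
    fun i j hij => Real.sqrt_le_sqrt (S.antitone hij), ?_, ?_, fun x z => ?_⟩
  · exact S.orthonormal_left.comp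
      (fun i : {i : ℕ // 0 < √(l i)} => (⟨i, hlp i i.2⟩ : {i : ℕ // 0 < l i}))
      fun i j hij => Subtype.ext (by simpa using hij)
  · rw [orthonormal_iff_ite]
    intro i j
    have hi := hlp i i.2
    have h1 : ⟪adjoint A (g i), adjoint A (g j)⟫ = if i = j then l i else 0 := by
      rw [adjoint_inner_left, real_inner_comm, ← comp_apply, S.apply_right (hlp j j.2),
        real_inner_smul_left, hgn _ _ (hlp j j.2)]
      simp only [Subtype.ext_iff, eq_comm (a := (j : ℕ))]
      split_ifs with hij
      · rw [hij, mul_one]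
      · rw [mul_zero]
    rw [real_inner_smul_left, inner_smul_right, h1]
    split_ifs with hij
    · rw [← hij]
      have : √(l i) ≠ 0 := i.2.ne'
      field_simp
      rw [hsq]
    · simp
  · -- The remainder of `x` after projection to `g₀, …, gₙ₋₁` tends to zero under `A†`.
    let w : ℕ → E := fun n => x - ∑ i ∈ Finset.range n, ⟪g i, x⟫ • g i
    have hw : ∀ n, ∀ i < n, 0 < l i → ⟪g i, w n⟫ = 0 := by
      intro n i hi hli
      simp only [w, inner_sub_right, inner_sum, inner_smul_right, hgn i _ hli, mul_ite, mul_one,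
        mul_zero]
      rw [Finset.sum_ite_eq, if_pos (Finset.mem_range.2 hi), sub_self]
    have hwn : ∀ n, ‖adjoint A (w n)‖ ^ 2
        = ⟪x, A (adjoint A x)⟫ - ∑ i ∈ Finset.range n, l i * ⟪g i, x⟫ * ⟪g i, x⟫ := by
      intro n
      have happ : ∀ i, A (adjoint A (g i)) = l i • g i := by
        intro i
        rcases (S.nonneg i).eq_or_lt with hi | hi
        · simp [hg0 i hi.symm]
        · exact S.apply_right hi
      have h1 : ⟪w n, A (adjoint A (w n))⟫ = ⟪w n, A (adjoint A x)⟫ := by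
        have : A (adjoint A (w n))
            = A (adjoint A x) - ∑ i ∈ Finset.range n, (⟪g i, x⟫ * l i) • g i := by
          simp only [w, map_sub, map_sum, map_smul, happ, smul_smul]
        rw [this, inner_sub_right, inner_sum, Finset.sum_eq_zero, sub_zero]
        intro i hi
        rw [inner_smul_right, real_inner_comm (g i)]
        rcases (S.nonneg i).eq_or_lt with h0 | h0
        · rw [← h0, mul_zero, zero_mul]
        · rw [hw n i (Finset.mem_range.1 hi) h0, mul_zero]
      rw [← real_inner_self_eq_norm_sq, adjoint_inner_left, h1]
      simp only [w, inner_sub_left, sum_inner, real_inner_smul_left]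
      congr 1
      refine Finset.sum_congr rfl fun i _ => ?_
      rw [← adjoint_inner_left, adjoint_inner_right, happ, real_inner_smul_left]
      ring
    have hlim : Tendsto (fun n => ‖adjoint A (w n)‖ ^ 2) atTop (𝓝 0) := by
      simp only [hwn]
      simpa using (S.expansion x x).const_sub ⟪x, A (adjoint A x)⟫
    have hlim' : Tendsto (fun n => ⟪adjoint A (w n), z⟫) atTop (𝓝 0) := by
      refine squeeze_zero_norm (a := fun n => ‖adjoint A (w n)‖ * ‖z‖)
        (fun n => norm_inner_le_norm _ _) ?_
      have : Tendsto (fun n => ‖adjoint A (w n)‖) atTop (𝓝 0) := by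
        simpa [Real.sqrt_sq] using hlim.sqrt
      simpa using this.mul_const ‖z‖
    have h2 : Tendsto (fun n => ⟪x, A z⟫ - ⟪adjoint A (w n), z⟫) atTop (𝓝 ⟪x, A z⟫) := by
      simpa using hlim'.const_sub ⟪x, A z⟫
    refine h2.congr fun n => ?_
    rw [adjoint_inner_left]
    simp only [w, inner_sub_left, sum_inner, real_inner_smul_left, sub_sub_cancel]
    refine Finset.sum_congr rfl fun i _ => ?_
    rw [adjoint_inner_left]
    rcases (S.nonneg i).eq_or_lt with hi | hi
    · simp [hg0 i hi.symm]
    · have : √(l i) ≠ 0 := (Real.sqrt_pos.2 hi).ne'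
      field_simp

/-- An operator whose Hilbert–Schmidt sums `∑ ‖A vᵢ‖²` over finite orthonormal families are bounded
is compact. -/
theorem isCompactOperator_of_sum_norm_sq_le {A : F →L[ℝ] E} {C : ℝ}
    (hA : ∀ (n : ℕ) (v : Fin n → F), Orthonormal ℝ v → ∑ i, ‖A (v i)‖ ^ 2 ≤ C) :
    IsCompactOperator A := by
  let s : Set ℝ := {r | ∃ (n : ℕ) (v : Fin n → F), Orthonormal ℝ v ∧ ∑ i, ‖A (v i)‖ ^ 2 = r}
  have hsb : BddAbove s := ⟨C, by rintro _ ⟨n, v, hv, rfl⟩; exact hA n v hv⟩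
  have hsn : s.Nonempty := ⟨0, 0, Fin.elim0, ⟨fun i => i.elim0, fun i => i.elim0⟩, by simp⟩
  -- Past a family that nearly attains the supremum, no further unit vector contributes much.
  have key : ∀ k : ℕ, ∃ B : F →L[ℝ] E, IsCompactOperator B ∧ ‖A - B‖ ≤ 1 / ((k : ℝ) + 1) := by
    intro k
    set ε : ℝ := 1 / ((k : ℝ) + 1) with hε
    have hε0 : 0 < ε := by positivity
    obtain ⟨r, ⟨n, v, hv, rfl⟩, hr⟩ := exists_lt_of_lt_csSup hsn
      (sub_lt_self (sSup s) (by positivity : 0 < ε ^ 2))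
    let P : F →L[ℝ] F := ∑ i, rankOne ℝ (v i) (v i)
    have hP : ∀ x, P x = ∑ i, ⟪v i, x⟫ • v i := fun x => by simp [P, sum_apply]
    have hbound : ∀ z, (∀ i, ⟪v i, z⟫ = 0) → ‖A z‖ ≤ ε * ‖z‖ := by
      intro z hz
      rcases eq_or_ne z 0 with rfl | hz0
      · simp
      have hu : Orthonormal ℝ (Fin.cons (‖z‖⁻¹ • z) v : Fin (n + 1) → F) := by
        constructor
        · intro i
          refine Fin.cases ?_ (fun j => ?_) i
          · simp [norm_smul, hz0]
          · simpa using hv.1 j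
        · intro i j
          refine Fin.cases ?_ (fun i => ?_) i <;> refine Fin.cases ?_ (fun j => ?_) j
          · exact fun h => absurd rfl h
          · intro _
            rw [Fin.cons_zero, Fin.cons_succ, real_inner_smul_left, real_inner_comm, hz, mul_zero]
          · intro _
            rw [Fin.cons_zero, Fin.cons_succ, inner_smul_right, hz, mul_zero]
          · intro hij
            simpa using hv.2 (fun h => hij (by rw [h]))
      have h1 : ∑ i, ‖A ((Fin.cons (‖z‖⁻¹ • z) v : Fin (n + 1) → F) i)‖ ^ 2 ≤ sSup s :=
        le_csSup hsb ⟨n + 1, _, hu, rfl⟩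
      rw [Fin.sum_univ_succ] at h1
      simp only [Fin.cons_zero, Fin.cons_succ, map_smul, norm_smul, norm_inv, norm_norm] at h1
      have h2 : (‖z‖⁻¹ * ‖A z‖) ^ 2 ≤ ε ^ 2 := by linarith
      have h3 := le_of_sq_le_sq h2 hε0.le
      rwa [inv_mul_le_iff₀ (norm_pos_iff.2 hz0), mul_comm] at h3
    refine ⟨A ∘L P, ?_, opNorm_le_bound _ hε0.le fun x => ?_⟩
    · have : A ∘L P = ∑ i, rankOne ℝ (A (v i)) (v i) := by
        ext x
        simp [hP, sum_apply]
      rw [this]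
      refine Submodule.sum_mem (compactOperator (RingHom.id ℝ) F E) fun i _ => ?_
      exact (isCompactOperator_of_locallyCompactSpace_rng (toSpanSingleton ℝ (A (v i)))).comp_clm
        (innerSL ℝ (v i))
    · have h1 : ∀ i, ⟪v i, x - P x⟫ = 0 := by
        intro i
        rw [hP, inner_sub_right, hv.inner_right_fintype, sub_self]
      have h2 : ‖x - P x‖ ≤ ‖x‖ := by
        have h3 : ⟪P x, x - P x⟫ = 0 := by
          conv_lhs => rw [hP x, sum_inner]
          refine Finset.sum_eq_zero fun i _ => ?_
          rw [← hP x, real_inner_smul_left, h1, mul_zero]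
        refine le_of_sq_le_sq ?_ (norm_nonneg x)
        have h4 : ‖x‖ ^ 2 = ‖P x‖ ^ 2 + ‖x - P x‖ ^ 2 := by
          have := norm_add_sq_real (P x) (x - P x)
          rw [h3, add_sub_cancel] at this
          linarith
        nlinarith [sq_nonneg ‖P x‖]
      have h5 : (A - A ∘L P) x = A (x - P x) := by simp
      rw [h5]
      exact (hbound _ h1).trans (by gcongr)
  choose B hB hAB using key
  refine isCompactOperator_of_tendsto (F := B) (l := atTop) ?_ (Eventually.of_forall hB)
  rw [tendsto_iff_norm_sub_tendsto_zero]
  refine squeeze_zero (fun k => norm_nonneg _) (fun k => ?_) tendsto_one_div_add_atTop_nhds_zero_nat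
  rw [norm_sub_rev]
  exact hAB k

end Existence

/-! ### Inserting an orthogonal projection -/

section Sandwich

open ContinuousLinearMap InnerProductSpace

variable {E F : Type*} [NormedAddCommGroup E] [InnerProductSpace ℝ E]
  [NormedAddCommGroup F] [InnerProductSpace ℝ F]
  {A : F →L[ℝ] E} {R : F →L[ℝ] F} {β γ : ℕ → ℝ} {g u : ℕ → E} {h v : ℕ → F}

local notation "⟪" x ", " y "⟫" => inner ℝ x y

theorem norm_sq_eq_inner_of_isIdempotentElem (hR : IsIdempotentElem R)
    (hsymm : ∀ x y, ⟪R x, y⟫ = ⟪x, R y⟫) (x : F) : ‖R x‖ ^ 2 = ⟪x, R x⟫ := by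
  have hRR : R (R x) = R x := congrArg (fun S : F →L[ℝ] F => S x) hR
  rw [← real_inner_self_eq_norm_sq, hsymm, hRR]

theorem norm_apply_le_of_isIdempotentElem (hR : IsIdempotentElem R)
    (hsymm : ∀ x y, ⟪R x, y⟫ = ⟪x, R y⟫) (x : F) : ‖R x‖ ≤ ‖x‖ := by
  have h1 := norm_sq_eq_inner_of_isIdempotentElem hR hsymm x
  have h2 := real_inner_le_norm x (R x)
  by_contra! hlt
  nlinarith [norm_nonneg x, norm_nonneg (R x)]

theorem eq_of_norm_le_norm_apply (hR : IsIdempotentElem R)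
    (hsymm : ∀ x y, ⟪R x, y⟫ = ⟪x, R y⟫) {x : F} (hx : ‖x‖ ≤ ‖R x‖) : R x = x := by
  have h1 := norm_sq_eq_inner_of_isIdempotentElem hR hsymm x
  have h2 := norm_sub_sq_real x (R x)
  have h3 := pow_le_pow_left₀ (norm_nonneg x) hx 2
  have h4 : ‖x - R x‖ ^ 2 ≤ 0 := by linarith
  have h5 : ‖x - R x‖ = 0 := by
    have := le_antisymm h4 (sq_nonneg _)
    exact pow_eq_zero_iff two_ne_zero |>.1 this
  exact (sub_eq_zero.1 (norm_eq_zero.1 h5)).symm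

namespace IsSingularSystem

theorem comp_eq_self (S : IsSingularSystem A β g h) (hsymm : ∀ x y, ⟪R x, y⟫ = ⟪x, R y⟫)
    (hfix : ∀ i, 0 < β i → R (h i) = h i) : A ∘L R = A := by
  ext z
  rw [comp_apply, ← sub_eq_zero, ← map_sub]
  refine S.apply_eq_zero fun i hi => ?_
  rw [inner_sub_right, ← hsymm, hfix i hi, sub_self]

theorem exists_multiplicity (S : IsSingularSystem A β g h) (hsum : Summable fun i => β i ^ 2)
    (h0 : 0 < β 0) : ∃ l : ℕ, ∀ i, β i = β 0 ↔ i < l := by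
  have h1 : ∃ i, β i < β 0 := by
    obtain ⟨i, hi⟩ := (hsum.tendsto_atTop_zero.eventually_lt_const
      (by positivity : 0 < β 0 ^ 2)).exists
    exact ⟨i, lt_of_pow_lt_pow_left₀ 2 h0.le hi⟩
  classical
  refine ⟨Nat.find h1, fun i => ⟨fun hi => ?_, fun hi => ?_⟩⟩
  · by_contra! hle
    exact absurd hi ((S.antitone hle).trans_lt (Nat.find_spec h1)).ne
  · exact le_antisymm (S.antitone (Nat.zero_le i)) (not_lt.1 (Nat.find_min h1 hi))

/-- `‖A z‖` attains `β₀ ‖z‖` only on the span of the top right singular vectors. -/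
theorem eq_sum_of_le_norm_apply [CompleteSpace E] [CompleteSpace F]
    (S : IsSingularSystem A β g h) {l : ℕ}
    (hl : ∀ i, β i = β 0 ↔ i < l) (h0 : 0 < β 0) {z : F} (hz : ‖z‖ = 1) (hAz : β 0 ≤ ‖A z‖) :
    z = ∑ i : Fin l, ⟪h i, z⟫ • h i := by
  have hlt : β l < β 0 :=
    lt_of_le_of_ne (S.antitone (Nat.zero_le l)) fun h => lt_irrefl l ((hl l).1 h)
  have hpos : ∀ i < l, 0 < β i := fun i hi => by rwa [(hl i).2 hi]
  set s : ℝ := ∑ i ∈ Finset.range l, ⟪h i, z⟫ ^ 2 with hs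
  have hle : ‖A z‖ ^ 2 ≤ β 0 ^ 2 * s + β l ^ 2 * (1 - s) := by
    refine le_of_tendsto (S.hasSum_norm_sq z).tendsto_sum_nat ?_
    filter_upwards [eventually_ge_atTop l] with n hn
    have h1 : s = ∑ i ∈ Finset.range l, (if 0 < β i then ⟪h i, z⟫ ^ 2 else 0) :=
      Finset.sum_congr rfl fun i hi => by rw [if_pos (hpos i (Finset.mem_range.1 hi))]
    have h2 := sum_range_ite_inner_sq_le S.orthonormal_right n z
    rw [hz, one_pow, ← Finset.sum_range_add_sum_Ico _ hn, ← h1] at h2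
    rw [← Finset.sum_range_add_sum_Ico _ hn]
    refine add_le_add (le_of_eq ?_) ?_
    · rw [hs, Finset.mul_sum]
      exact Finset.sum_congr rfl fun i hi => by rw [(hl i).2 (Finset.mem_range.1 hi)]
    · calc ∑ i ∈ Finset.Ico l n, β i ^ 2 * ⟪h i, z⟫ ^ 2
          ≤ ∑ i ∈ Finset.Ico l n, β l ^ 2 * (if 0 < β i then ⟪h i, z⟫ ^ 2 else 0) := by
            refine Finset.sum_le_sum fun i hi => ?_
            split_ifs with hi0
            · have := pow_le_pow_left₀ (S.nonneg i) (S.antitone (Finset.mem_Ico.1 hi).1) 2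
              gcongr
            · rw [le_antisymm (not_lt.1 hi0) (S.nonneg i)]
              simp
        _ ≤ β l ^ 2 * (1 - s) := by
            rw [← Finset.mul_sum]
            exact mul_le_mul_of_nonneg_left (by linarith) (sq_nonneg _)
  have h1 := pow_le_pow_left₀ h0.le hAz 2
  have h2 := pow_lt_pow_left₀ hlt (S.nonneg l) two_ne_zero
  have h3 : 1 ≤ s := by
    by_contra! hs1
    nlinarith
  have ho := orthonormal_fin_of_pos S.orthonormal_right hpos
  have h4 : ‖z - ∑ i : Fin l, ⟪h i, z⟫ • h i‖ ^ 2 = 1 - s := by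
    have h5 : ⟪z, ∑ i : Fin l, ⟪h i, z⟫ • h i⟫ = s := by
      rw [inner_sum, hs, ← Fin.sum_univ_eq_sum_range (fun i => ⟪h i, z⟫ ^ 2)]
      refine Finset.sum_congr rfl fun i _ => ?_
      rw [inner_smul_right, real_inner_comm, sq]
    have h6 : ‖∑ i : Fin l, ⟪h i, z⟫ • h i‖ ^ 2 = s := by
      rw [← real_inner_self_eq_norm_sq, ho.inner_sum, hs,
        ← Fin.sum_univ_eq_sum_range (fun i => ⟪h i, z⟫ ^ 2)]
      exact Finset.sum_congr rfl fun i _ => by simp [sq]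
    rw [norm_sub_sq_real, h5, h6, hz]
    ring
  have h5 : ‖z - ∑ i : Fin l, ⟪h i, z⟫ • h i‖ = 0 :=
    (pow_eq_zero_iff two_ne_zero).1 (le_antisymm (by linarith) (sq_nonneg _))
  exact sub_eq_zero.1 (norm_eq_zero.1 h5)

end IsSingularSystem

variable [CompleteSpace E] [CompleteSpace F]

theorem adjoint_comp_of_symm (hsymm : ∀ x y, ⟪R x, y⟫ = ⟪x, R y⟫) :
    ContinuousLinearMap.adjoint (A ∘L R) = R ∘L ContinuousLinearMap.adjoint A := by
  rw [adjoint_comp]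
  congr 1
  exact ((eq_adjoint_iff R R).2 hsymm).symm

/-- The sandwich `A R A†` is the Gram operator of `A R`. -/
theorem comp_comp_adjoint_eq (hR : IsIdempotentElem R) (hsymm : ∀ x y, ⟪R x, y⟫ = ⟪x, R y⟫) :
    A ∘L R ∘L ContinuousLinearMap.adjoint A
      = (A ∘L R) ∘L ContinuousLinearMap.adjoint (A ∘L R) := by
  rw [adjoint_comp_of_symm hsymm]
  ext x
  have hRR : ∀ x, R (R x) = R x := fun x => congrArg (fun S : F →L[ℝ] F => S x) hR
  simp only [comp_apply, hRR]

namespace IsSingularSystem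

/-- The right singular vectors of `A R` lie in the range of `R`. -/
theorem apply_right_of_comp (S' : IsSingularSystem (A ∘L R) γ u v) (hR : IsIdempotentElem R)
    (hsymm : ∀ x y, ⟪R x, y⟫ = ⟪x, R y⟫) {j : ℕ} (hj : 0 < γ j) : R (v j) = v j := by
  have h1 := S'.adjoint.apply_right hj
  rw [adjoint_comp_of_symm hsymm, comp_apply] at h1
  have h2 : v j = (γ j)⁻¹ • R (ContinuousLinearMap.adjoint A (u j)) := by
    rw [h1, inv_smul_smul₀ hj.ne']
  have hRR : ∀ x, R (R x) = R x := fun x => congrArg (fun S : F →L[ℝ] F => S x) hR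
  rw [h2, map_smul, hRR]

theorem sq_le_sq_of_comp (S : IsSingularSystem A β g h) (S' : IsSingularSystem (A ∘L R) γ u v)
    (hR : IsIdempotentElem R) (hsymm : ∀ x y, ⟪R x, y⟫ = ⟪x, R y⟫) (i : ℕ) :
    γ i ^ 2 ≤ β i ^ 2 := by
  refine S'.comp_adjoint.le_of_inner_le S.comp_adjoint (fun x => ?_) i
  have key : ∀ B : F →L[ℝ] E, ⟪x, (B ∘L ContinuousLinearMap.adjoint B) x⟫
      = ‖ContinuousLinearMap.adjoint B x‖ ^ 2 := fun B => by
    rw [comp_apply, ← adjoint_inner_left, real_inner_self_eq_norm_sq]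
  rw [key, key, adjoint_comp_of_symm hsymm]
  exact pow_le_pow_left₀ (norm_nonneg _) (norm_apply_le_of_isIdempotentElem hR hsymm _) 2

/-- `∑ γⱼ² = ∑ βᵢ²` forces every `hᵢ` into the range of `R`: expanding
`γⱼ² = ‖A vⱼ‖² = ∑ᵢ βᵢ² ⟪R hᵢ, vⱼ⟫²` and summing over `j` first, Bessel's inequality gives
`∑ γⱼ² ≤ ∑ βᵢ² ‖R hᵢ‖²`. -/
theorem apply_right_eq_of_tsum_eq (S : IsSingularSystem A β g h)
    (S' : IsSingularSystem (A ∘L R) γ u v) (hR : IsIdempotentElem R)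
    (hsymm : ∀ x y, ⟪R x, y⟫ = ⟪x, R y⟫) (hsum : Summable fun i => β i ^ 2)
    (heq : ∑' i, γ i ^ 2 = ∑' i, β i ^ 2) (i : ℕ) (hi : 0 < β i) : R (h i) = h i := by
  have hle : ∀ i, β i ^ 2 * ‖R (h i)‖ ^ 2 ≤ β i ^ 2 := by
    intro i
    rcases (S.nonneg i).eq_or_lt with h0 | h0
    · simp [← h0]
    · have h1 := norm_apply_le_of_isIdempotentElem hR hsymm (h i)
      rw [S.norm_right h0] at h1
      exact mul_le_of_le_one_right (sq_nonneg _) (pow_le_one₀ (norm_nonneg _) h1)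
  have hsum' : Summable fun i => β i ^ 2 * ‖R (h i)‖ ^ 2 :=
    Summable.of_nonneg_of_le (fun i => by positivity) hle hsum
  have hfin : ∀ m, ∑ j ∈ Finset.range m, γ j ^ 2 ≤ ∑' i, β i ^ 2 * ‖R (h i)‖ ^ 2 := by
    intro m
    have h1 : HasSum (fun i => ∑ j ∈ Finset.range m,
        β i ^ 2 * (if 0 < γ j then ⟪v j, R (h i)⟫ ^ 2 else 0))
        (∑ j ∈ Finset.range m, γ j ^ 2) := by
      refine hasSum_sum fun j _ => ?_
      rcases (S'.nonneg j).eq_or_lt with h0 | h0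
      · simp [← h0, hasSum_zero]
      · have hRv := S'.apply_right_of_comp hR hsymm h0
        have hAv : ‖A (v j)‖ ^ 2 = γ j ^ 2 := by
          have := S'.apply_right h0
          rw [comp_apply, hRv] at this
          rw [this, norm_smul, S'.norm_left h0, mul_one, Real.norm_of_nonneg h0.le]
        rw [← hAv]
        simpa only [if_pos h0, ← hsymm, hRv, real_inner_comm] using S.hasSum_norm_sq (v j)
    rw [← h1.tsum_eq]
    refine h1.summable.tsum_le_tsum (fun i => ?_) hsum'
    rw [← Finset.mul_sum]
    exact mul_le_mul_of_nonneg_left (sum_range_ite_inner_sq_le S'.orthonormal_right m _)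
      (sq_nonneg _)
  have hge : ∑' i, β i ^ 2 ≤ ∑' i, β i ^ 2 * ‖R (h i)‖ ^ 2 := by
    rw [← heq]
    exact Real.tsum_le_of_sum_range_le (fun i => sq_nonneg _) hfin
  refine eq_of_norm_le_norm_apply hR hsymm ?_
  by_contra! hlt
  refine absurd hge (not_le.2 (Summable.tsum_lt_tsum hle (i := i) ?_ hsum' hsum))
  rw [S.norm_right hi] at hlt
  exact mul_lt_of_lt_one_right (by positivity) (pow_lt_one₀ (norm_nonneg _) hlt two_ne_zero)

/-- Inserting the projection `R` decreases the top singular value strictly if and only if `R` fixes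
no nonzero vector in the span of the top right singular vectors. -/
theorem lt_iff_of_comp (S : IsSingularSystem A β g h) (S' : IsSingularSystem (A ∘L R) γ u v)
    (hR : IsIdempotentElem R) (hsymm : ∀ x y, ⟪R x, y⟫ = ⟪x, R y⟫) {l : ℕ}
    (hl : ∀ i, β i = β 0 ↔ i < l) (h0 : 0 < β 0) :
    γ 0 < β 0 ↔ ∀ a : Fin l → ℝ, R (∑ i, a i • h i) = ∑ i, a i • h i → a = 0 := by
  have hpos : ∀ i < l, 0 < β i := fun i hi => by rwa [(hl i).2 hi]
  have hoh := orthonormal_fin_of_pos S.orthonormal_right hpos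
  have hog := orthonormal_fin_of_pos S.orthonormal_left hpos
  constructor
  · intro hlt a ha
    have h1 : A (∑ i, a i • h i) = β 0 • ∑ i : Fin l, a i • g i := by
      rw [map_sum, Finset.smul_sum]
      refine Finset.sum_congr rfl fun i _ => ?_
      rw [map_smul, S.apply_right (hpos i i.2), (hl i).2 i.2, smul_comm]
    have h2 : ‖∑ i : Fin l, a i • g i‖ = ‖∑ i : Fin l, a i • h i‖ := by
      rw [← sq_eq_sq₀ (norm_nonneg _) (norm_nonneg _), ← real_inner_self_eq_norm_sq,
        ← real_inner_self_eq_norm_sq, hog.inner_sum, hoh.inner_sum]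
    have h3 := (A ∘L R).le_opNorm (∑ i, a i • h i)
    rw [comp_apply, ha, h1, norm_smul, h2, S'.norm_eq, Real.norm_of_nonneg h0.le] at h3
    have h4 : ∑ i, a i • h i = 0 := by
      by_contra hne
      have := norm_pos_iff.2 hne
      nlinarith
    exact funext fun i => Fintype.linearIndependent_iff.1 hoh.linearIndependent a h4 i
  · intro ha
    by_contra! hle
    have hγ : 0 < γ 0 := h0.trans_le hle
    have hRv := S'.apply_right_of_comp hR hsymm hγ
    have hAv : ‖A (v 0)‖ = γ 0 := by
      have := S'.apply_right hγ
      rw [comp_apply, hRv] at this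
      rw [this, norm_smul, S'.norm_left hγ, mul_one, Real.norm_of_nonneg hγ.le]
    have hv := S.eq_sum_of_le_norm_apply hl h0 (S'.norm_right hγ) (hle.trans_eq hAv.symm)
    have h1 := ha (fun i => ⟪h i, v 0⟫) (by rw [← hv, hRv])
    have h2 : v 0 = 0 := by
      rw [hv]
      refine Finset.sum_eq_zero fun i _ => ?_
      rw [show ⟪h i, v 0⟫ = 0 from congrFun h1 i, zero_smul]
    have := S'.norm_right hγ
    rw [h2, norm_zero] at this
    exact zero_ne_one this

end IsSingularSystem

end Sandwich

/-! ### Product functions in `L²` of a product measure -/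

section Tensor

variable {α β : Type*} [MeasurableSpace α] [MeasurableSpace β] {π : Measure α} {ρ : Measure β}

theorem memLp_mul_prod [SFinite π] [SFinite ρ] (u : Lp ℝ 2 π) (v : Lp ℝ 2 ρ) :
    MemLp (fun p : α × β => u p.1 * v p.2) 2 (π.prod ρ) := by
  have hm : AEStronglyMeasurable (fun p : α × β => u p.1 * v p.2) (π.prod ρ) :=
    ((Lp.stronglyMeasurable u).comp_measurable measurable_fst).aestronglyMeasurable.mul
      ((Lp.stronglyMeasurable v).comp_measurable measurable_snd).aestronglyMeasurable
  rw [memLp_two_iff_integrable_sq hm]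
  simpa only [mul_pow] using ((Lp.memLp u).integrable_sq).mul_prod ((Lp.memLp v).integrable_sq)

/-- The function `(x, y) ↦ u(x) v(y)` as an element of `L²(π × ρ)`. -/
noncomputable def tensor [SFinite π] [SFinite ρ] (u : Lp ℝ 2 π) (v : Lp ℝ 2 ρ) :
    Lp ℝ 2 (π.prod ρ) :=
  (memLp_mul_prod u v).toLp _

theorem coeFn_tensor [SFinite π] [SFinite ρ] (u : Lp ℝ 2 π) (v : Lp ℝ 2 ρ) :
    tensor u v =ᵐ[π.prod ρ] fun p => u p.1 * v p.2 :=
  (memLp_mul_prod u v).coeFn_toLp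

theorem inner_eq_integral_mul (u v : Lp ℝ 2 π) : inner ℝ u v = ∫ x, u x * v x ∂π := by
  rw [L2.inner_def]
  exact integral_congr_ae (ae_of_all _ fun x => by simp [mul_comm])

theorem inner_tensor_right [SFinite π] [SFinite ρ] (w : Lp ℝ 2 (π.prod ρ)) (u : Lp ℝ 2 π)
    (v : Lp ℝ 2 ρ) : inner ℝ w (tensor u v) = ∫ p, w p * (u p.1 * v p.2) ∂(π.prod ρ) := by
  rw [inner_eq_integral_mul]
  refine integral_congr_ae ?_
  filter_upwards [coeFn_tensor u v] with p hp
  rw [hp]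

theorem inner_tensor_tensor [SFinite π] [SFinite ρ] (u u' : Lp ℝ 2 π) (v v' : Lp ℝ 2 ρ) :
    inner ℝ (tensor u v) (tensor u' v') = inner ℝ u u' * inner ℝ v v' := by
  rw [inner_tensor_right, inner_eq_integral_mul, inner_eq_integral_mul, ← integral_prod_mul]
  refine integral_congr_ae ?_
  filter_upwards [coeFn_tensor u v] with p hp
  rw [hp]
  ring

theorem tensor_add_left [SFinite π] [SFinite ρ] (u u' : Lp ℝ 2 π) (v : Lp ℝ 2 ρ) :
    tensor (u + u') v = tensor u v + tensor u' v := by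
  apply Lp.ext
  filter_upwards [coeFn_tensor (u + u') v, coeFn_tensor u v, coeFn_tensor u' v,
    Lp.coeFn_add (tensor u v) (tensor u' v),
    Measure.quasiMeasurePreserving_fst.ae (Lp.coeFn_add u u')] with p h1 h2 h3 h4 h5
  rw [h1, h4, Pi.add_apply, h2, h3, h5, Pi.add_apply, add_mul]

theorem tensor_add_right [SFinite π] [SFinite ρ] (u : Lp ℝ 2 π) (v v' : Lp ℝ 2 ρ) :
    tensor u (v + v') = tensor u v + tensor u v' := by
  apply Lp.ext
  filter_upwards [coeFn_tensor u (v + v'), coeFn_tensor u v, coeFn_tensor u v',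
    Lp.coeFn_add (tensor u v) (tensor u v'),
    Measure.quasiMeasurePreserving_snd.ae (Lp.coeFn_add v v')] with p h1 h2 h3 h4 h5
  rw [h1, h4, Pi.add_apply, h2, h3, h5, Pi.add_apply, mul_add]

variable [IsFiniteMeasure π] [IsFiniteMeasure ρ]

/-- Product functions are total in `L²(π × ρ)`. -/
theorem eq_zero_of_inner_tensor {w : Lp ℝ 2 (π.prod ρ)}
    (hw : ∀ (u : Lp ℝ 2 π) (v : Lp ℝ 2 ρ), inner ℝ w (tensor u v) = 0) : w = 0 := by
  have hwi : Integrable w (π.prod ρ) := (Lp.memLp w).integrable (by norm_num)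
  have hrect : ∀ s t, MeasurableSet s → MeasurableSet t →
      ∫ p in s ×ˢ t, w p ∂(π.prod ρ) = 0 := by
    intro s t hs ht
    rw [← hw (indicatorConstLp 2 hs (measure_ne_top π s) 1)
      (indicatorConstLp 2 ht (measure_ne_top ρ t) 1), inner_tensor_right,
      ← integral_indicator (hs.prod ht)]
    refine integral_congr_ae ?_
    have h1 := (Measure.quasiMeasurePreserving_fst (μ := π) (ν := ρ)).ae
      (indicatorConstLp_coeFn (p := 2) (hs := hs) (hμs := measure_ne_top π s) (c := (1 : ℝ)))
    have h2 := (Measure.quasiMeasurePreserving_snd (μ := π) (ν := ρ)).ae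
      (indicatorConstLp_coeFn (p := 2) (hs := ht) (hμs := measure_ne_top ρ t) (c := (1 : ℝ)))
    filter_upwards [h1, h2] with p h1 h2
    rw [h1, h2]
    by_cases hp1 : p.1 ∈ s <;> by_cases hp2 : p.2 ∈ t <;>
      simp [Set.indicator, Set.mem_prod, hp1, hp2]
  have hall : ∀ s, MeasurableSet s → ∫ p in s, w p ∂(π.prod ρ) = 0 := by
    intro s hs
    induction s, hs using MeasurableSpace.induction_on_inter generateFrom_prod.symm
      isPiSystem_prod with
    | empty => simp
    | basic s hs =>
      obtain ⟨s, hs, t, ht, rfl⟩ := hs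
      exact hrect s t hs ht
    | compl s hs ih =>
      rw [setIntegral_compl hs hwi, ih, sub_zero]
      simpa using hrect Set.univ Set.univ .univ .univ
    | iUnion s hd hs ih =>
      rw [integral_iUnion hs hd hwi.integrableOn]
      simp [ih]
  rw [Lp.eq_zero_iff_ae_eq_zero]
  exact hwi.ae_eq_zero_of_forall_setIntegral_eq_zero fun s hs _ => hall s hs

end Tensor

/-! ### Mean zero functions -/

section MeanZero

variable {α β : Type*} [MeasurableSpace α] [MeasurableSpace β] {π : Measure α} {ρ : Measure β}

theorem inner_const_left [IsFiniteMeasure π] (c : ℝ) (u : Lp ℝ 2 π) :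
    inner ℝ (Lp.const 2 π c) u = c * ∫ x, u x ∂π := by
  rw [inner_eq_integral_mul, ← integral_const_mul]
  refine integral_congr_ae ?_
  filter_upwards [Lp.coeFn_const (p := 2) (μ := π) c] with x hx
  rw [hx, Function.const_apply]

theorem inner_const_left_of_mem [IsFiniteMeasure π] (c : ℝ) (u : L20 π) :
    inner ℝ (Lp.const 2 π c) (u : Lp ℝ 2 π) = 0 := by
  have : ∫ x, u.1 x ∂π = 0 := u.2
  rw [inner_const_left, this, mul_zero]

theorem isClosed_L20 [IsFiniteMeasure π] : IsClosed (L20 π : Set (Lp ℝ 2 π)) := by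
  have : (L20 π : Set (Lp ℝ 2 π)) = {u | inner ℝ (Lp.const 2 π (1 : ℝ)) u = 0} := by
    ext u
    rw [Set.mem_ofPred_eq, inner_const_left, one_mul]
    rfl
  rw [this]
  exact isClosed_eq (by fun_prop) continuous_const

instance completeSpace_L20 [IsFiniteMeasure π] : CompleteSpace (L20 π) :=
  (isClosed_L20 (π := π)).completeSpace_coe

/-- `L²` is the sum of the mean zero functions and the constants. -/
theorem exists_eq_add_const [IsProbabilityMeasure π] (u : Lp ℝ 2 π) :
    ∃ (u₀ : L20 π) (c : ℝ), u = u₀ + Lp.const 2 π c := by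
  refine ⟨⟨u - Lp.const 2 π (∫ x, u x ∂π), ?_⟩, ∫ x, u x ∂π, by simp⟩
  show ∫ x, (u - Lp.const 2 π (∫ x, u x ∂π) : Lp ℝ 2 π) x ∂π = 0
  have hu : Integrable u π := (Lp.memLp u).integrable (by norm_num)
  have h1 : (u - Lp.const 2 π (∫ x, u x ∂π) : Lp ℝ 2 π) =ᵐ[π] fun x => u x - ∫ x, u x ∂π := by
    filter_upwards [Lp.coeFn_sub u (Lp.const 2 π (∫ x, u x ∂π)),
      Lp.coeFn_const (p := 2) (μ := π) (∫ x, u x ∂π)] with x h1 h2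
    rw [h1, Pi.sub_apply, h2, Function.const_apply]
  rw [integral_congr_ae h1, integral_sub hu (integrable_const _)]
  simp

theorem eq_zero_of_inner_tensor_L20 [IsProbabilityMeasure π] [IsProbabilityMeasure ρ]
    {w : Lp ℝ 2 (π.prod ρ)} (h00 : ∀ (u : L20 π) (v : L20 ρ), inner ℝ w (tensor u.1 v.1) = 0)
    (h01 : ∀ (u : L20 π) (c : ℝ), inner ℝ w (tensor u.1 (Lp.const 2 ρ c)) = 0)
    (h10 : ∀ (c : ℝ) (v : L20 ρ), inner ℝ w (tensor (Lp.const 2 π c) v.1) = 0)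
    (h11 : ∀ c d : ℝ, inner ℝ w (tensor (Lp.const 2 π c) (Lp.const 2 ρ d)) = 0) : w = 0 := by
  refine eq_zero_of_inner_tensor fun u v => ?_
  obtain ⟨u, c, rfl⟩ := exists_eq_add_const u
  obtain ⟨v, d, rfl⟩ := exists_eq_add_const v
  rw [tensor_add_left, tensor_add_right, tensor_add_right, inner_add_right, inner_add_right,
    inner_add_right, h00, h01, h10, h11]
  simp

end MeanZero

/-! ### Composition and adjoints of the operators of transition functions -/

section KernelOp

variable {α β γ : Type*} [MeasurableSpace α] [MeasurableSpace β] [MeasurableSpace γ]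
  {κ : Kernel α β} {π : Measure α} {π' : Measure β}

theorem coeFn_kernelOp [IsFiniteMeasure π] [IsFiniteMeasure π'] (h : Transports κ π π')
    (v : L20 π') : (kernelOp κ π π' h v).1 =ᵐ[π] fun x => ∫ y, v.1 y ∂κ x :=
  (h.memLp v.1).coeFn_toLp

theorem norm_kernelOp_le [IsFiniteMeasure π] [IsFiniteMeasure π'] (h : Transports κ π π') :
    ‖kernelOp κ π π' h‖ ≤ 1 :=
  LinearMap.mkContinuous_norm_le _ zero_le_one _

theorem kernelOp_congr {κ₁ κ₂ : Kernel α β} [IsFiniteMeasure π] [IsFiniteMeasure π']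
    (h₁ : Transports κ₁ π π') (h₂ : Transports κ₂ π π') (h : κ₁ = κ₂) :
    kernelOp κ₁ π π' h₁ = kernelOp κ₂ π π' h₂ := by
  subst h
  rfl

/-- Composition of transition functions reverses the order of the operators. -/
theorem kernelOp_comp {η : Kernel β γ} {π'' : Measure γ} [IsFiniteMeasure π] [IsFiniteMeasure π']
    [IsFiniteMeasure π''] (hη : Transports η π' π'') (hκ : Transports κ π π') :
    kernelOp (η ∘ₖ κ) π π'' (hη.comp hκ) = kernelOp κ π π' hκ ∘L kernelOp η π' π'' hη := by
  have := hη.isFiniteKernel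
  have := hκ.isFiniteKernel
  ext1 v
  apply Subtype.ext
  apply Lp.ext
  refine (coeFn_kernelOp _ v).trans ?_
  refine EventuallyEq.trans ?_ (coeFn_kernelOp hκ (kernelOp η π' π'' hη v)).symm
  have hint : ∀ᵐ x ∂π, Integrable v.1 ((η ∘ₖ κ) x) := by
    have hc : Integrable v.1 (π.bind (η ∘ₖ κ)) := by
      rw [(hη.comp hκ).bind_eq]
      exact (Lp.memLp v.1).integrable (by norm_num)
    exact Measure.ae_integrable_of_integrable_comp hc
  filter_upwards [hint, hκ.ae_ae (coeFn_kernelOp hη v)] with x h1 h2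
  rw [Kernel.integral_comp h1]
  exact (integral_congr_ae h2).symm

theorem integrable_mul_of_map_eq {J : Measure (α × β)} (h1 : J.map Prod.fst = π)
    (h2 : J.map Prod.snd = π') (u : Lp ℝ 2 π) (v : Lp ℝ 2 π') :
    Integrable (fun p : α × β => u p.1 * v p.2) J := by
  have hu : MemLp (fun p : α × β => u p.1) 2 J :=
    (Lp.memLp u).comp_measurePreserving ⟨measurable_fst, h1⟩
  have hv : MemLp (fun p : α × β => v p.2) 2 J :=
    (Lp.memLp v).comp_measurePreserving ⟨measurable_snd, h2⟩
  exact hu.integrable_mul hv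

theorem integral_mul_const_of_map_eq [IsFiniteMeasure π'] {J : Measure (α × β)}
    (h1 : J.map Prod.fst = π) (h2 : J.map Prod.snd = π') (u : Lp ℝ 2 π) (c : ℝ) :
    ∫ p, u p.1 * (Lp.const 2 π' c) p.2 ∂J = (∫ x, u x ∂π) * c := by
  have h3 : ∫ p, u p.1 ∂J = ∫ x, u x ∂π := by
    have := integral_map (μ := J) measurable_fst.aemeasurable
      (Lp.stronglyMeasurable u).aestronglyMeasurable
    rw [h1] at this
    exact this.symm
  have hq : Measure.QuasiMeasurePreserving Prod.snd J π' := ⟨measurable_snd, h2.absolutelyContinuous⟩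
  rw [← h3, ← integral_mul_const]
  refine integral_congr_ae ?_
  filter_upwards [hq.ae (Lp.coeFn_const (p := 2) (μ := π') c)] with p hp
  rw [hp, Function.const_apply]

theorem integral_const_mul_of_map_eq [IsFiniteMeasure π] {J : Measure (α × β)}
    (h1 : J.map Prod.fst = π) (h2 : J.map Prod.snd = π') (c : ℝ) (v : Lp ℝ 2 π') :
    ∫ p, (Lp.const 2 π c) p.1 * v p.2 ∂J = c * ∫ y, v y ∂π' := by
  have h3 : ∫ p, v p.2 ∂J = ∫ y, v y ∂π' := by
    have := integral_map (μ := J) measurable_snd.aemeasurable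
      (Lp.stronglyMeasurable v).aestronglyMeasurable
    rw [h2] at this
    exact this.symm
  have hq : Measure.QuasiMeasurePreserving Prod.fst J π := ⟨measurable_fst, h1.absolutelyContinuous⟩
  rw [← h3, ← integral_const_mul]
  refine integral_congr_ae ?_
  filter_upwards [hq.ae (Lp.coeFn_const (p := 2) (μ := π) c)] with p hp
  rw [hp, Function.const_apply]

theorem Transports.map_snd_compProd [SFinite π] [IsSFiniteKernel κ] (h : Transports κ π π') :
    (π ⊗ₘ κ).map Prod.snd = π' := by
  rw [← h.bind_eq]
  exact Measure.snd_compProd π κ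

/-- The bilinear form of the operator of `κ` is integration against the joint law `π(dx) κ(x, dy)`,
provided its first marginal is `π` (as `κ` may lose mass on a null set, this is an assumption). -/
theorem inner_kernelOp [IsFiniteMeasure π] [IsFiniteMeasure π'] [IsFiniteKernel κ]
    (h : Transports κ π π') (hfst : (π ⊗ₘ κ).map Prod.fst = π) (u : L20 π) (v : L20 π') :
    inner ℝ u (kernelOp κ π π' h v) = ∫ p, u.1 p.1 * v.1 p.2 ∂(π ⊗ₘ κ) := by
  rw [Submodule.coe_inner, inner_eq_integral_mul, Measure.integral_compProd
    (integrable_mul_of_map_eq hfst h.map_snd_compProd u.1 v.1)]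
  refine integral_congr_ae ?_
  filter_upwards [coeFn_kernelOp h v] with x hx
  rw [hx, integral_const_mul]

/-- Two transition functions with the same joint law, up to the order of the variables, define
operators adjoint to each other. -/
theorem inner_kernelOp_eq [IsFiniteMeasure π] [IsFiniteMeasure π'] {η : Kernel β α}
    (hκ : Transports κ π π') (hη : Transports η π' π)
    (hJ : π ⊗ₘ κ = (π' ⊗ₘ η).map Prod.swap) (u : L20 π) (v : L20 π') :
    inner ℝ (kernelOp κ π π' hκ v) u = inner ℝ v (kernelOp η π' π hη u) := by
  have := hκ.isFiniteKernel
  have := hη.isFiniteKernel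
  have hJ' : (π ⊗ₘ κ).map Prod.swap = π' ⊗ₘ η := by
    rw [hJ, Measure.map_map measurable_swap measurable_swap, Prod.swap_swap_eq, Measure.map_id]
  have h1 : (π ⊗ₘ κ).map Prod.fst = π := by
    rw [hJ, Measure.map_map measurable_fst measurable_swap]
    exact hη.map_snd_compProd
  have h2 : (π' ⊗ₘ η).map Prod.fst = π' := by
    rw [← hJ', Measure.map_map measurable_fst measurable_swap]
    exact hκ.map_snd_compProd
  rw [real_inner_comm, inner_kernelOp hκ h1, inner_kernelOp hη h2, ← hJ']
  refine Eq.trans ?_ (integral_map_equiv MeasurableEquiv.prodComm _).symm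
  exact integral_congr_ae (ae_of_all _ fun p => mul_comm _ _)

end KernelOp

/-! ### The joint density and its conditional expectation operators -/

namespace JointDensity

variable {X Y : Type*} [MeasurableSpace X] [MeasurableSpace Y] {μ : Measure X} {ν : Measure Y}

instance isFiniteKernel_kernelYgX [SFinite μ] [SFinite ν] (f : JointDensity μ ν) :
    IsFiniteKernel f.kernelYgX :=
  f.transports_kernelYgX.isFiniteKernel

instance isFiniteKernel_kernelXgY [SFinite μ] [SFinite ν] (f : JointDensity μ ν) :
    IsFiniteKernel f.kernelXgY :=
  f.transports_kernelXgY.isFiniteKernel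

theorem ae_fX_ne_top (f : JointDensity μ ν) [SFinite ν] : ∀ᵐ x ∂μ, f.fX x ≠ ∞ := by
  filter_upwards [ae_lt_top f.measurable_fX (by rw [f.lintegral_fX]; simp)] with x hx
  exact hx.ne

theorem ae_fY_ne_top (f : JointDensity μ ν) [SFinite μ] [SFinite ν] : ∀ᵐ y ∂ν, f.fY y ≠ ∞ := by
  filter_upwards [ae_lt_top f.measurable_fY (by rw [f.lintegral_fY]; simp)] with y hy
  exact hy.ne

theorem compProd_kernelYgX_prod [SFinite μ] [SFinite ν] (f : JointDensity μ ν) {s : Set X}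
    {t : Set Y} (hs : MeasurableSet s) (ht : MeasurableSet t) :
    (f.lawX ⊗ₘ f.kernelYgX) (s ×ˢ t) = ∫⁻ x in s, ∫⁻ y in t, f.toFun x y ∂ν ∂μ := by
  rw [Measure.compProd_apply_prod hs ht, lawX, restrict_withDensity hs,
    lintegral_withDensity_eq_lintegral_mul _ f.measurable_fX (f.kernelYgX.measurable_coe ht)]
  refine lintegral_congr_ae (ae_restrict_of_ae ?_)
  filter_upwards [f.ae_fX_ne_top] with x hx
  have hm : Measurable (fun y => f.fYgX y x) := f.measurable_fYgX.comp measurable_prodMk_left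
  rw [Pi.mul_apply, kernelYgX_apply, withDensity_apply _ ht, ← lintegral_const_mul _ hm]
  exact lintegral_congr_ae (ae_restrict_of_ae (f.fX_mul_fYgX hx))

theorem compProd_kernelXgY_prod [SFinite μ] [SFinite ν] (f : JointDensity μ ν) {s : Set X}
    {t : Set Y} (hs : MeasurableSet s) (ht : MeasurableSet t) :
    (f.lawY ⊗ₘ f.kernelXgY) (t ×ˢ s) = ∫⁻ y in t, ∫⁻ x in s, f.toFun x y ∂μ ∂ν := by
  rw [Measure.compProd_apply_prod ht hs, lawY, restrict_withDensity ht,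
    lintegral_withDensity_eq_lintegral_mul _ f.measurable_fY (f.kernelXgY.measurable_coe hs)]
  refine lintegral_congr_ae (ae_restrict_of_ae ?_)
  filter_upwards [f.ae_fY_ne_top] with y hy
  have hm : Measurable (fun x => f.fXgY x y) := f.measurable_fXgY.comp measurable_prodMk_right
  rw [Pi.mul_apply, kernelXgY_apply, withDensity_apply _ hs, ← lintegral_const_mul _ hm]
  exact lintegral_congr_ae (ae_restrict_of_ae (f.fY_mul_fXgY hy))

theorem compProd_kernelYgX_eq_map_swap [SFinite μ] [SFinite ν] (f : JointDensity μ ν) :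
    f.lawX ⊗ₘ f.kernelYgX = (f.lawY ⊗ₘ f.kernelXgY).map Prod.swap := by
  refine Measure.ext_prod fun {s t} hs ht => ?_
  rw [Measure.map_apply measurable_swap (hs.prod ht), Set.preimage_swap_prod,
    f.compProd_kernelYgX_prod hs ht, f.compProd_kernelXgY_prod hs ht]
  exact lintegral_lintegral_swap f.measurable_coe.aemeasurable

theorem map_fst_compProd_kernelYgX [SFinite μ] [SFinite ν] (f : JointDensity μ ν) :
    (f.lawX ⊗ₘ f.kernelYgX).map Prod.fst = f.lawX := by
  rw [compProd_kernelYgX_eq_map_swap, Measure.map_map measurable_fst measurable_swap]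
  exact f.transports_kernelXgY.map_snd_compProd

/-- The conditional expectation operator `h ↦ E[h(y) | x]`. -/
noncomputable def condOp [SFinite μ] [SFinite ν] (f : JointDensity μ ν) :
    L20 f.lawY →L[ℝ] L20 f.lawX :=
  kernelOp f.kernelYgX f.lawX f.lawY f.transports_kernelYgX

theorem adjoint_condOp [SFinite μ] [SFinite ν] (f : JointDensity μ ν) :
    ContinuousLinearMap.adjoint f.condOp
      = kernelOp f.kernelXgY f.lawY f.lawX f.transports_kernelXgY := by
  refine ((ContinuousLinearMap.eq_adjoint_iff _ _).2 fun u v => ?_).symm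
  rw [real_inner_comm v, real_inner_comm (f.condOp v)]
  exact (inner_kernelOp_eq f.transports_kernelYgX f.transports_kernelXgY
    f.compProd_kernelYgX_eq_map_swap u v).symm

theorem opK_eq [SFinite μ] [SFinite ν] (f : JointDensity μ ν) :
    f.opK = f.condOp ∘L ContinuousLinearMap.adjoint f.condOp := by
  rw [adjoint_condOp, condOp, ← kernelOp_comp]
  exact kernelOp_congr _ _ f.daKernel_eq_comp

theorem opKstar_eq [SFinite μ] [SFinite ν] (f : JointDensity μ ν) (R : Kernel Y Y)
    [IsMarkovKernel R] (hR : R.IsReversible f.lawY) :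
    f.opKstar R hR = f.condOp ∘L f.opR R hR ∘L ContinuousLinearMap.adjoint f.condOp := by
  rw [adjoint_condOp, condOp, opR, ← ContinuousLinearMap.comp_assoc, ← kernelOp_comp,
    ← kernelOp_comp]
  refine kernelOp_congr _ _ ?_
  rw [sandwichKernel_eq_comp]

theorem inner_opR_left [SFinite μ] [SFinite ν] (f : JointDensity μ ν) (R : Kernel Y Y)
    [IsMarkovKernel R] (hR : R.IsReversible f.lawY) (u v : L20 f.lawY) :
    inner ℝ (f.opR R hR u) v = inner ℝ u (f.opR R hR v) := by
  refine inner_kernelOp_eq _ _ ?_ v u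
  refine Measure.ext_prod fun {s t} hs ht => ?_
  rw [Measure.map_apply measurable_swap (hs.prod ht), Set.preimage_swap_prod,
    Measure.compProd_apply_prod hs ht, Measure.compProd_apply_prod ht hs]
  exact hR hs ht

/-- The density `f(x, y) / (f_X(x) f_Y(y))` of the joint law relative to the product of its
marginals. -/
noncomputable def relDensity (f : JointDensity μ ν) (p : X × Y) : ℝ≥0∞ :=
  f.toFun p.1 p.2 / (f.fX p.1 * f.fY p.2)

theorem measurable_fX_mul_fY [SFinite μ] [SFinite ν] (f : JointDensity μ ν) :
    Measurable fun p : X × Y => f.fX p.1 * f.fY p.2 :=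
  (f.measurable_fX.comp measurable_fst).mul (f.measurable_fY.comp measurable_snd)

theorem measurable_relDensity [SFinite μ] [SFinite ν] (f : JointDensity μ ν) :
    Measurable f.relDensity :=
  f.measurable_coe.div f.measurable_fX_mul_fY

/-- Almost everywhere the marginal densities are finite, and they vanish only where `f` does. -/
theorem ae_marginals [SFinite μ] [SFinite ν] (f : JointDensity μ ν) :
    ∀ᵐ p ∂(μ.prod ν), f.fX p.1 ≠ ∞ ∧ f.fY p.2 ≠ ∞ ∧
      (f.fX p.1 = 0 → f.toFun p.1 p.2 = 0) ∧ (f.fY p.2 = 0 → f.toFun p.1 p.2 = 0) := by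
  have h1 : ∀ᵐ p ∂(μ.prod ν), f.fX p.1 ≠ ∞ :=
    Measure.quasiMeasurePreserving_fst.ae f.ae_fX_ne_top
  have h2 : ∀ᵐ p ∂(μ.prod ν), f.fY p.2 ≠ ∞ :=
    Measure.quasiMeasurePreserving_snd.ae f.ae_fY_ne_top
  have h3 : ∀ᵐ p ∂(μ.prod ν), f.fX p.1 * f.fYgX p.2 p.1 = f.toFun p.1 p.2 := by
    have hm : MeasurableSet {p : X × Y | f.fX p.1 * f.fYgX p.2 p.1 = f.toFun p.1 p.2} :=
      measurableSet_eq_fun ((f.measurable_fX.comp measurable_fst).mul f.measurable_fYgX)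
        f.measurable_coe
    rw [Measure.ae_prod_iff_ae_ae hm]
    filter_upwards [f.ae_fX_ne_top] with x hx
    exact f.fX_mul_fYgX hx
  have h4 : ∀ᵐ p ∂(μ.prod ν), f.fY p.2 * f.fXgY p.1 p.2 = f.toFun p.1 p.2 := by
    have hm : MeasurableSet {p : X × Y | f.fY p.2 * f.fXgY p.1 p.2 = f.toFun p.1 p.2} :=
      measurableSet_eq_fun ((f.measurable_fY.comp measurable_snd).mul f.measurable_fXgY)
        f.measurable_coe
    rw [Measure.ae_prod_iff_ae_ae hm, Measure.ae_ae_comm hm]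
    filter_upwards [f.ae_fY_ne_top] with y hy
    exact f.fY_mul_fXgY hy
  filter_upwards [h1, h2, h3, h4] with p h1 h2 h3 h4
  refine ⟨h1, h2, fun h => ?_, fun h => ?_⟩
  · rw [h, zero_mul] at h3
    exact_mod_cast h3.symm
  · rw [h, zero_mul] at h4
    exact_mod_cast h4.symm

/-- The relative density is the density of the joint law, here `f_X(x) μ(dx) f_{Y|X}(y | x) ν(dy)`. -/
theorem prod_withDensity_relDensity [SFinite μ] [SFinite ν] (f : JointDensity μ ν) :
    (f.lawX.prod f.lawY).withDensity f.relDensity = f.lawX ⊗ₘ f.kernelYgX := by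
  have h1 : (f.lawX.prod f.lawY).withDensity f.relDensity
      = (μ.prod ν).withDensity (fun p => (f.toFun p.1 p.2 : ℝ≥0∞)) := by
    rw [lawX, lawY, prod_withDensity f.measurable_fX f.measurable_fY,
      ← withDensity_mul _ f.measurable_fX_mul_fY f.measurable_relDensity]
    refine withDensity_congr_ae ?_
    filter_upwards [f.ae_marginals] with p ⟨h1, h2, h3, h4⟩
    rw [Pi.mul_apply, relDensity]
    by_cases hX : f.fX p.1 = 0
    · simp [h3 hX]
    by_cases hY : f.fY p.2 = 0
    · simp [h4 hY]
    exact ENNReal.mul_div_cancel (mul_ne_zero hX hY) (ENNReal.mul_ne_top h1 h2)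
  rw [h1]
  refine (Measure.ext_prod fun {s t} hs ht => ?_).symm
  rw [f.compProd_kernelYgX_prod hs ht, withDensity_apply _ (hs.prod ht), ← Measure.prod_restrict,
    lintegral_prod _ f.measurable_coe.aemeasurable]

/-- The integral in `TraceCondition` is the squared `L²` norm of the relative density. -/
theorem lintegral_relDensity_sq [SFinite μ] [SFinite ν] (f : JointDensity μ ν) :
    ∫⁻ p, f.relDensity p ^ 2 ∂(f.lawX.prod f.lawY)
      = ∫⁻ x, ∫⁻ y, f.fXgY x y * f.fYgX y x ∂ν ∂μ := by
  rw [lawX, lawY, prod_withDensity f.measurable_fX f.measurable_fY,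
    lintegral_withDensity_eq_lintegral_mul _ f.measurable_fX_mul_fY
      (f.measurable_relDensity.pow_const 2),
    ← lintegral_prod (fun p : X × Y => f.fXgY p.1 p.2 * f.fYgX p.2 p.1)
      (f.measurable_fXgY.mul f.measurable_fYgX).aemeasurable]
  refine lintegral_congr_ae ?_
  filter_upwards [f.ae_marginals] with p ⟨h1, h2, h3, h4⟩
  rw [Pi.mul_apply, relDensity, fXgY, fYgX]
  by_cases hX : f.fX p.1 = 0
  · simp [h3 hX]
  by_cases hY : f.fY p.2 = 0
  · simp [h4 hY]
  have h0 : f.fX p.1 * f.fY p.2 ≠ 0 := mul_ne_zero hX hY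
  have ht : f.fX p.1 * f.fY p.2 ≠ ∞ := ENNReal.mul_ne_top h1 h2
  rw [sq, ← mul_assoc, ENNReal.mul_div_cancel h0 ht, div_eq_mul_inv, div_eq_mul_inv,
    div_eq_mul_inv, ENNReal.mul_inv (Or.inl hX) (Or.inl h1)]
  ring

theorem TraceCondition.memLp [SFinite μ] [SFinite ν] {f : JointDensity μ ν}
    (hf : f.TraceCondition) :
    MemLp (fun p => (f.relDensity p).toReal) 2 (f.lawX.prod f.lawY) := by
  rw [memLp_two_iff_integrable_sq f.measurable_relDensity.ennreal_toReal.aestronglyMeasurable]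
  simp only [← ENNReal.toReal_pow]
  refine integrable_toReal_of_lintegral_ne_top (f.measurable_relDensity.pow_const 2).aemeasurable ?_
  rw [lintegral_relDensity_sq]
  exact hf.ne

theorem TraceCondition.ae_lt_top [SFinite μ] [SFinite ν] {f : JointDensity μ ν}
    (hf : f.TraceCondition) : ∀ᵐ p ∂(f.lawX.prod f.lawY), f.relDensity p < ∞ := by
  have h1 := MeasureTheory.ae_lt_top (μ := f.lawX.prod f.lawY)
    (f.measurable_relDensity.pow_const 2) (by rw [lintegral_relDensity_sq]; exact hf.ne)
  filter_upwards [h1] with p hp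
  by_contra! h
  rw [top_le_iff.1 h] at hp
  simp at hp

theorem TraceCondition.inner_toLp_tensor [SFinite μ] [SFinite ν] {f : JointDensity μ ν}
    (hf : f.TraceCondition) (u : Lp ℝ 2 f.lawX) (v : Lp ℝ 2 f.lawY) :
    inner ℝ (hf.memLp.toLp _) (tensor u v) = ∫ p, u p.1 * v p.2 ∂(f.lawX ⊗ₘ f.kernelYgX) := by
  rw [inner_tensor_right, ← prod_withDensity_relDensity,
    integral_withDensity_eq_integral_toReal_smul f.measurable_relDensity hf.ae_lt_top]
  refine integral_congr_ae ?_
  filter_upwards [hf.memLp.coeFn_toLp] with p hp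
  rw [hp, smul_eq_mul]

theorem TraceCondition.inner_toLp_tensor_L20 [SFinite μ] [SFinite ν] {f : JointDensity μ ν}
    (hf : f.TraceCondition) (u : L20 f.lawX) (v : L20 f.lawY) :
    inner ℝ (hf.memLp.toLp _) (tensor u.1 v.1) = inner ℝ u (f.condOp v) := by
  rw [hf.inner_toLp_tensor, condOp, inner_kernelOp _ f.map_fst_compProd_kernelYgX]

/-- The Hilbert–Schmidt sums of `condOp` are bounded by the squared norm of the relative density:
`∑ ‖A vᵢ‖²` is the inner product of this density with `∑ (A vᵢ) ⊗ vᵢ`, whose squared norm is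
again `∑ ‖A vᵢ‖²`. -/
theorem TraceCondition.sum_norm_sq_condOp_le [SFinite μ] [SFinite ν] {f : JointDensity μ ν}
    (hf : f.TraceCondition) {n : ℕ} {v : Fin n → L20 f.lawY} (hv : Orthonormal ℝ v) :
    ∑ i, ‖f.condOp (v i)‖ ^ 2 ≤ ‖hf.memLp.toLp _‖ ^ 2 := by
  set c := ∑ i, ‖f.condOp (v i)‖ ^ 2 with hc
  let w := ∑ i, tensor (f.condOp (v i)).1 (v i).1
  have h1 : inner ℝ (hf.memLp.toLp _) w = c := by
    rw [inner_sum, hc]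
    refine Finset.sum_congr rfl fun i _ => ?_
    rw [hf.inner_toLp_tensor_L20, real_inner_self_eq_norm_sq]
  have h2 : ‖w‖ ^ 2 = c := by
    have hvi : ∀ i j, inner ℝ (v i).1 (v j).1 = if i = j then (1 : ℝ) else 0 :=
      orthonormal_iff_ite.1 hv
    rw [← real_inner_self_eq_norm_sq, sum_inner, hc]
    refine Finset.sum_congr rfl fun i _ => ?_
    rw [inner_sum]
    simp only [inner_tensor_tensor, hvi, mul_ite, mul_one, mul_zero]
    rw [Finset.sum_ite_eq, if_pos (Finset.mem_univ i), ← Submodule.coe_inner,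
      real_inner_self_eq_norm_sq]
  have h3 : c ≤ ‖hf.memLp.toLp _‖ * ‖w‖ := h1 ▸ real_inner_le_norm _ _
  have h4 : 0 ≤ (‖hf.memLp.toLp _‖ - ‖w‖) ^ 2 := sq_nonneg _
  nlinarith

theorem TraceCondition.isCompactOperator_condOp [SFinite μ] [SFinite ν] {f : JointDensity μ ν}
    (hf : f.TraceCondition) : IsCompactOperator f.condOp :=
  isCompactOperator_of_sum_norm_sq_le fun _ _ hv => hf.sum_norm_sq_condOp_le hv

end JointDensity

/-! ### Singular value decompositions of the joint density -/

namespace JointDensity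

variable {X Y : Type*} [MeasurableSpace X] [MeasurableSpace Y] {μ : Measure X} {ν : Measure Y}
  [SFinite μ] [SFinite ν] {f : JointDensity μ ν} {β : ℕ → ℝ} {g : ℕ → L20 f.lawX}
  {h : ℕ → L20 f.lawY}

theorem coeFn_one_add_sum_tensor (β : ℕ → ℝ) (g : ℕ → L20 f.lawX) (h : ℕ → L20 f.lawY) (n : ℕ) :
    (Lp.const 2 (f.lawX.prod f.lawY) (1 : ℝ)
        + ∑ i ∈ Finset.range n, β i • tensor (g i).1 (h i).1 : Lp ℝ 2 (f.lawX.prod f.lawY))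
      =ᵐ[f.lawX.prod f.lawY]
        fun p => 1 + ∑ i ∈ Finset.range n, β i * (g i).1 p.1 * (h i).1 p.2 := by
  induction n with
  | zero =>
    simp only [Finset.range_zero, Finset.sum_empty, add_zero]
    exact Lp.coeFn_const (p := 2) (μ := f.lawX.prod f.lawY) (1 : ℝ)
  | succ n ih =>
    simp only [Finset.sum_range_succ, ← add_assoc]
    filter_upwards [ih, Lp.coeFn_add (Lp.const 2 (f.lawX.prod f.lawY) (1 : ℝ)
      + ∑ i ∈ Finset.range n, β i • tensor (g i).1 (h i).1) (β n • tensor (g n).1 (h n).1),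
      Lp.coeFn_smul (β n) (tensor (g n).1 (h n).1), coeFn_tensor (g n).1 (h n).1]
      with p h1 h2 h3 h4
    rw [h2, Pi.add_apply, h1, h3, Pi.smul_apply, h4, smul_eq_mul, mul_assoc]

/-- The expansion of the relative density in `L²`, as convergence of vectors of this space. -/
theorem TraceCondition.expansion_iff (hf : f.TraceCondition) :
    Tendsto (fun n : ℕ => eLpNorm (fun p : X × Y =>
      ((f.toFun p.1 p.2 : ℝ≥0∞) / (f.fX p.1 * f.fY p.2)).toReal
        - (1 + ∑ i ∈ Finset.range n, β i * (g i).1 p.1 * (h i).1 p.2))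
      2 (f.lawX.prod f.lawY)) atTop (𝓝 0) ↔
    Tendsto (fun n : ℕ => ∑ i ∈ Finset.range n, β i • tensor (g i).1 (h i).1) atTop
      (𝓝 (hf.memLp.toLp _ - Lp.const 2 (f.lawX.prod f.lawY) (1 : ℝ))) := by
  have h1 : ∀ n : ℕ, eLpNorm (fun p : X × Y =>
      ((f.toFun p.1 p.2 : ℝ≥0∞) / (f.fX p.1 * f.fY p.2)).toReal
        - (1 + ∑ i ∈ Finset.range n, β i * (g i).1 p.1 * (h i).1 p.2))
      2 (f.lawX.prod f.lawY)
      = edist (∑ i ∈ Finset.range n, β i • tensor (g i).1 (h i).1)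
        (hf.memLp.toLp _ - Lp.const 2 (f.lawX.prod f.lawY) (1 : ℝ)) := by
    intro n
    have h2 : edist (∑ i ∈ Finset.range n, β i • tensor (g i).1 (h i).1)
        (hf.memLp.toLp _ - Lp.const 2 (f.lawX.prod f.lawY) (1 : ℝ))
        = ‖hf.memLp.toLp _ - (Lp.const 2 (f.lawX.prod f.lawY) (1 : ℝ)
          + ∑ i ∈ Finset.range n, β i • tensor (g i).1 (h i).1)‖ₑ := by
      rw [edist_comm, edist_eq_enorm_sub, sub_sub]
    rw [h2, Lp.enorm_def]
    refine eLpNorm_congr_ae ?_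
    filter_upwards [hf.memLp.coeFn_toLp, coeFn_one_add_sum_tensor β g h n,
      Lp.coeFn_sub (hf.memLp.toLp _) (Lp.const 2 (f.lawX.prod f.lawY) (1 : ℝ)
        + ∑ i ∈ Finset.range n, β i • tensor (g i).1 (h i).1)] with p h3 h4 h5
    rw [h5, Pi.sub_apply, h3, h4]
    rfl
  simp only [h1]
  exact tendsto_iff_edist_tendsto_0.symm

theorem const_one_eq_tensor :
    Lp.const 2 (f.lawX.prod f.lawY) (1 : ℝ)
      = tensor (Lp.const 2 f.lawX (1 : ℝ)) (Lp.const 2 f.lawY (1 : ℝ)) := by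
  apply Lp.ext
  filter_upwards [coeFn_tensor (Lp.const 2 f.lawX (1 : ℝ)) (Lp.const 2 f.lawY (1 : ℝ)),
    Lp.coeFn_const (p := 2) (μ := f.lawX.prod f.lawY) (1 : ℝ),
    Measure.quasiMeasurePreserving_fst.ae (Lp.coeFn_const (p := 2) (μ := f.lawX) (1 : ℝ)),
    Measure.quasiMeasurePreserving_snd.ae (Lp.coeFn_const (p := 2) (μ := f.lawY) (1 : ℝ))]
    with p h1 h2 h3 h4
  rw [h1, h2, h3, h4]
  simp

theorem inner_sum_tensor (n : ℕ) (u : Lp ℝ 2 f.lawX) (v : Lp ℝ 2 f.lawY) :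
    inner ℝ (∑ i ∈ Finset.range n, β i • tensor (g i).1 (h i).1) (tensor u v)
      = ∑ i ∈ Finset.range n, β i * inner ℝ (g i).1 u * inner ℝ (h i).1 v := by
  rw [sum_inner]
  refine Finset.sum_congr rfl fun i _ => ?_
  rw [real_inner_smul_left, inner_tensor_tensor, mul_assoc]

/-- A singular value decomposition of `f` is one of the operator `condOp`. -/
theorem IsSVD.isSingularSystem (hf : f.TraceCondition) (S : f.IsSVD β g h) :
    IsSingularSystem f.condOp β g h where
  nonneg i := (S.mem_Icc i).1
  antitone := S.antitone
  orthonormal_left := S.orthonormal_left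
  orthonormal_right := S.orthonormal_right
  expansion u v := by
    have h1 := (hf.expansion_iff.1 S.expansion).inner
      (tendsto_const_nhds (x := tensor u.1 v.1)) (𝕜 := ℝ)
    rw [inner_sub_left, hf.inner_toLp_tensor_L20, const_one_eq_tensor, inner_tensor_tensor,
      inner_const_left_of_mem, zero_mul, sub_zero] at h1
    simpa only [inner_sum_tensor, Submodule.coe_inner] using h1

theorem orthonormal_tensor (S : IsSingularSystem f.condOp β g h) :
    Orthonormal ℝ (fun i : {i : ℕ // 0 < β i} => tensor (g i).1 (h i).1) := by
  rw [orthonormal_iff_ite]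
  intro i j
  rw [inner_tensor_tensor, ← Submodule.coe_inner, ← Submodule.coe_inner,
    inner_eq_ite_of_orthonormal_pos S.orthonormal_left i.2 j.2,
    inner_eq_ite_of_orthonormal_pos S.orthonormal_right i.2 j.2]
  simp only [Subtype.ext_iff]
  split_ifs <;> simp

theorem TraceCondition.summable_sq (hf : f.TraceCondition)
    (S : IsSingularSystem f.condOp β g h) : Summable fun i => β i ^ 2 := by
  refine summable_of_sum_range_le (c := ‖hf.memLp.toLp _‖ ^ 2) (fun i => sq_nonneg _) fun n => ?_
  refine le_of_eq_of_le (Finset.sum_congr rfl fun i _ => ?_)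
    (sum_range_ite_inner_sq_le (g := fun i => tensor (g i).1 (h i).1) (orthonormal_tensor S) n _)
  split_ifs with hi
  · rw [real_inner_comm, hf.inner_toLp_tensor_L20, S.apply_right hi, inner_smul_right,
      real_inner_self_eq_norm_sq, S.norm_left hi, one_pow, mul_one]
  · rw [le_antisymm (not_lt.1 hi) (S.nonneg i)]
    simp

/-- A singular value decomposition of the operator `condOp` is one of `f`: the orthogonal series
`∑ βᵢ gᵢ ⊗ hᵢ` converges, and it has the same inner products with all product functions as the
relative density minus one. -/
theorem TraceCondition.isSVD (hf : f.TraceCondition) (S : IsSingularSystem f.condOp β g h) :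
    f.IsSVD β g h where
  mem_Icc i := ⟨S.nonneg i, (S.antitone (Nat.zero_le i)).trans
    (S.norm_eq.symm.trans_le (norm_kernelOp_le _))⟩
  antitone := S.antitone
  orthonormal_left := S.orthonormal_left
  orthonormal_right := S.orthonormal_right
  expansion := by
    rw [hf.expansion_iff]
    have hs : Summable fun i => β i • tensor (g i).1 (h i).1 := by
      have hinj := Subtype.val_injective (p := fun i => 0 < β i)
      rw [← hinj.summable_iff fun i hi => ?_]
      · have := (orthonormal_tensor S).orthogonalFamily.summable_iff_norm_sq_summable
          fun i : {i : ℕ // 0 < β i} => β i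
        simp only [LinearIsometry.toSpanSingleton_apply, Real.norm_eq_abs, sq_abs] at this
        exact this.2 ((hf.summable_sq S).comp_injective hinj)
      · have : ¬ 0 < β i := fun h => hi ⟨⟨i, h⟩, rfl⟩
        rw [le_antisymm (not_lt.1 this) (S.nonneg i), zero_smul]
    have ht := hs.hasSum.tendsto_sum_nat
    have hinner : ∀ (u : Lp ℝ 2 f.lawX) (v : Lp ℝ 2 f.lawY), Tendsto
        (fun n => ∑ i ∈ Finset.range n, β i * inner ℝ (g i).1 u * inner ℝ (h i).1 v) atTop
        (𝓝 (inner ℝ (∑' i, β i • tensor (g i).1 (h i).1) (tensor u v))) := by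
      intro u v
      have := ht.inner (tendsto_const_nhds (x := tensor u v)) (𝕜 := ℝ)
      simpa only [inner_sum_tensor] using this
    have hzero : ∀ (u : Lp ℝ 2 f.lawX) (v : Lp ℝ 2 f.lawY),
        (∀ i, inner ℝ (g i).1 u * inner ℝ (h i).1 v = 0) →
        inner ℝ (∑' i, β i • tensor (g i).1 (h i).1) (tensor u v) = 0 := by
      intro u v huv
      refine tendsto_nhds_unique (hinner u v) ?_
      simp [mul_assoc, huv]
    have hgc : ∀ (c : ℝ) (u : L20 f.lawX), inner ℝ u.1 (Lp.const 2 f.lawX c) = 0 := fun c u => by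
      rw [real_inner_comm, inner_const_left_of_mem]
    have hhc : ∀ (c : ℝ) (v : L20 f.lawY), inner ℝ v.1 (Lp.const 2 f.lawY c) = 0 := fun c v => by
      rw [real_inner_comm, inner_const_left_of_mem]
    have hfst := f.map_fst_compProd_kernelYgX
    have hsnd := f.transports_kernelYgX.map_snd_compProd
    have hint : ∀ c : ℝ, ∫ x, (Lp.const 2 f.lawX c) x ∂f.lawX = c := fun c => by
      rw [integral_congr_ae (Lp.coeFn_const (p := 2) (μ := f.lawX) c)]
      simp
    have hint' : ∀ d : ℝ, ∫ y, (Lp.const 2 f.lawY d) y ∂f.lawY = d := fun d => by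
      rw [integral_congr_ae (Lp.coeFn_const (p := 2) (μ := f.lawY) d)]
      simp
    have hw : hf.memLp.toLp _ - Lp.const 2 (f.lawX.prod f.lawY) (1 : ℝ)
        - ∑' i, β i • tensor (g i).1 (h i).1 = 0 := by
      refine eq_zero_of_inner_tensor_L20 (fun u v => ?_) (fun u d => ?_) (fun c v => ?_)
        fun c d => ?_
      · rw [inner_sub_left, inner_sub_left, hf.inner_toLp_tensor_L20, const_one_eq_tensor,
          inner_tensor_tensor, inner_const_left_of_mem, zero_mul, sub_zero, sub_eq_zero]
        exact tendsto_nhds_unique (S.expansion u v) (hinner u.1 v.1)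
      · rw [inner_sub_left, inner_sub_left, hzero _ _ fun i => by rw [hhc, mul_zero],
          const_one_eq_tensor, inner_tensor_tensor, inner_const_left_of_mem, zero_mul, sub_zero,
          sub_zero]
        rw [hf.inner_toLp_tensor, integral_mul_const_of_map_eq hfst hsnd,
          show ∫ x, u.1 x ∂f.lawX = 0 from u.2, zero_mul]
      · rw [inner_sub_left, inner_sub_left, hzero _ _ fun i => by rw [hgc, zero_mul],
          const_one_eq_tensor, inner_tensor_tensor, inner_const_left_of_mem, mul_zero, sub_zero,
          sub_zero]
        rw [hf.inner_toLp_tensor, integral_const_mul_of_map_eq hfst hsnd,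
          show ∫ y, v.1 y ∂f.lawY = 0 from v.2, mul_zero]
      · rw [inner_sub_left, inner_sub_left, hzero _ _ fun i => by rw [hgc, zero_mul],
          const_one_eq_tensor, inner_tensor_tensor, sub_zero]
        rw [hf.inner_toLp_tensor, integral_mul_const_of_map_eq hfst hsnd, inner_const_left,
          inner_const_left, hint, hint', one_mul, one_mul, sub_self]
    rw [← sub_eq_zero.1 hw] at ht
    exact ht

end JointDensity

/-! ### Comparison of the two chains -/

theorem isPositiveTraceClass_of_isSingularSystem {E : Type*} [NormedAddCommGroup E]
    [InnerProductSpace ℝ E] {T : E →L[ℝ] E} {l : ℕ → ℝ} {e : ℕ → E} (hpos : T.IsPositive)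
    (hc : IsCompactOperator T) (S : IsSingularSystem T l e e) (hl : Summable l) :
    IsPositiveTraceClass T :=
  ⟨hpos, hc, by rwa [show eigenvalue T = l from funext S.eigenvalue_eq]⟩

end DataAugmentation

open DataAugmentation in
theorem theorem1 {X : Type*} {Y : Type*} [MeasurableSpace X] [MeasurableSpace Y]
    [MeasurableSpace.CountablyGenerated X] [MeasurableSpace.CountablyGenerated Y]
    (μ : MeasureTheory.Measure X) (ν : MeasureTheory.Measure Y)
    [MeasureTheory.SigmaFinite μ] [MeasureTheory.SigmaFinite ν]
    (f : DataAugmentation.JointDensity μ ν) (hf : f.TraceCondition)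
    (R : ProbabilityTheory.Kernel Y Y) [ProbabilityTheory.IsMarkovKernel R]
    (hR : R.IsReversible f.lawY)
    (hidem : IsIdempotentElem (f.opR R hR)) (hnorm : ‖f.opR R hR‖ = 1) :
    DataAugmentation.IsPositiveTraceClass f.opK ∧
    DataAugmentation.IsPositiveTraceClass (f.opKstar R hR) ∧
    (∀ i, DataAugmentation.eigenvalue (f.opKstar R hR) i ≤ DataAugmentation.eigenvalue f.opK i) ∧
    (∃ (β : ℕ → ℝ) (g : ℕ → DataAugmentation.L20 f.lawX) (h : ℕ → DataAugmentation.L20 f.lawY),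
      f.IsSVD β g h) ∧
    ∀ (β : ℕ → ℝ) (g : ℕ → DataAugmentation.L20 f.lawX) (h : ℕ → DataAugmentation.L20 f.lawY),
      f.IsSVD β g h →
      ((∀ i, DataAugmentation.eigenvalue (f.opKstar R hR) i = DataAugmentation.eigenvalue f.opK i) ↔
        ∀ i, 0 < β i → f.opR R hR (h i) = h i) ∧
      (DataAugmentation.trace (f.opKstar R hR) = DataAugmentation.trace f.opK ↔
        ∀ i, 0 < β i → f.opR R hR (h i) = h i) ∧
      (0 < β 0 → ∃ l : ℕ, (∀ i, β i = β 0 ↔ i < l) ∧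
        (‖f.opKstar R hR‖ < ‖f.opK‖ ↔
          ∀ a : Fin l → ℝ, f.opR R hR (∑ i, a i • h i) = ∑ i, a i • h i → a = 0)) := by
  have hsymm := f.inner_opR_left R hR
  have hc := hf.isCompactOperator_condOp
  have hcR : IsCompactOperator (f.condOp ∘L f.opR R hR) := hc.comp_clm _
  have hK := f.opK_eq
  have hKs : f.opKstar R hR = (f.condOp ∘L f.opR R hR) ∘L
      ContinuousLinearMap.adjoint (f.condOp ∘L f.opR R hR) := by
    rw [f.opKstar_eq, comp_comp_adjoint_eq hidem hsymm]
  obtain ⟨γ, u, v, S'⟩ := exists_isSingularSystem hcR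
  obtain ⟨β₁, g₁, h₁, S₁⟩ := exists_isSingularSystem hc
  have hsum₁ := hf.summable_sq S₁
  have hsumγ : Summable fun i => γ i ^ 2 :=
    Summable.of_nonneg_of_le (fun i => sq_nonneg _) (S₁.sq_le_sq_of_comp S' hidem hsymm) hsum₁
  have hes : ∀ i, eigenvalue (f.opKstar R hR) i = γ i ^ 2 := fun i => by
    rw [hKs, S'.comp_adjoint.eigenvalue_eq]
  have he : ∀ {β g h}, IsSingularSystem f.condOp β g h → ∀ i, eigenvalue f.opK i = β i ^ 2 :=
    fun S i => by rw [hK, S.comp_adjoint.eigenvalue_eq]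
  refine ⟨?_, ?_, fun i => ?_, ⟨β₁, g₁, h₁, hf.isSVD S₁⟩, fun β g h hsvd => ?_⟩
  · rw [hK]
    exact isPositiveTraceClass_of_isSingularSystem
      (ContinuousLinearMap.isPositive_self_comp_adjoint _) (hc.comp_clm _) S₁.comp_adjoint hsum₁
  · rw [hKs]
    exact isPositiveTraceClass_of_isSingularSystem
      (ContinuousLinearMap.isPositive_self_comp_adjoint _) (hcR.comp_clm _) S'.comp_adjoint hsumγ
  · rw [hes, he S₁]
    exact S₁.sq_le_sq_of_comp S' hidem hsymm i
  have S := hsvd.isSingularSystem hf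
  have hsum := hf.summable_sq S
  have htrace : trace (f.opKstar R hR) = trace f.opK ↔ ∑' i, γ i ^ 2 = ∑' i, β i ^ 2 := by
    simp only [trace, hes, he S]
  have hfix : trace (f.opKstar R hR) = trace f.opK → ∀ i, 0 < β i → f.opR R hR (h i) = h i :=
    fun ht => S.apply_right_eq_of_tsum_eq S' hidem hsymm hsum (htrace.1 ht)
  have hop : (∀ i, 0 < β i → f.opR R hR (h i) = h i) → f.opKstar R hR = f.opK := fun h => by
    rw [hKs, hK, S.comp_eq_self hsymm h]
  refine ⟨⟨fun h => hfix (by simp only [trace, h]), fun h i => by rw [hop h]⟩,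
    ⟨hfix, fun h => by rw [hop h]⟩, fun h0 => ?_⟩
  obtain ⟨l, hl⟩ := S.exists_multiplicity hsum h0
  refine ⟨l, hl, ?_⟩
  rw [← S.lt_iff_of_comp S' hidem hsymm hl h0, hKs, hK, S'.comp_adjoint.norm_eq,
    S.comp_adjoint.norm_eq]
  exact pow_lt_pow_iff_left₀ (S'.nonneg 0) (S.nonneg 0) two_ne_zero
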